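/- Let $M$ be a simply connected complex manifold and $K\to M$ a holomorphic vector bundle of finite rank. Consider data $(C,\mathcal U,g)$ on $K$ consisting of a holomorphic one-form $C\in\Omega^1(M,\mathrm{End}\,K)$, a holomorphic endomorphism $\mathcal U$ and a holomorphic symmetric non-degenerate bilinear form $g$, such that all $C_X$ and $\mathcal U$ commute and are $g$-symmetric. A Saito structure is such data together with a flat holomorphic connection $\nabla^r$ and a holomorphic, $\nabla^r$-flat endomorphism $\mathcal V$ with $$\nabla^r_X(C_Y)-\nabla^r_Y(C_X)-C_{[X,Y]}=0,\quad \nabla^r(\mathcal U)-[C,\mathcal V]+C=0,\quad \nabla^r(g)=0,\quad g(\mathcal Va,b)+g(a,\mathcal Vb)=0 .$$ ($\nabla^r$ is extended to smooth sections of $K$ by $\bar\partial$.) A CV-structure is such data together with a smooth fibrewise $\mathbb C$-antilinear involution $\kappa$ with $g(\kappa a,\kappa b)=\overline{g(a,b)}$, a non-degenerate, possibly indefinite, hermitian form $h=g(\cdot,\kappa\,\cdot)$ with Chern connection $D$, and a smooth endomorphism $\mathcal Q$, such that $D(\kappa)=0$, $D_X(C_Y)-D_Y(C_X)-C_{[X,Y]}=0$,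 $R^D(X,\bar Y)+[C_X,\kappa C_Y\kappa]=0$ for holomorphic vector fields $X,Y$, and $$g(\mathcal Qa,b)=-g(a,\mathcal Qb),\quad D^{(1,0)}(\mathcal U)-[C,\mathcal Q]+C=0,\quad D^{(1,0)}(\mathcal Q)+[C,\kappa\,\mathcal U\kappa]=0,\quad h(\mathcal Qa,b)=h(a,\mathcal Qb).$$ Let $(K,C,\mathcal U,g,\nabla^r,\mathcal V)$ be a Saito structure and $(K,\widehat C,\widehat{\mathcal U},\widehat g,\kappa,h,D,\mathcal Q)$ a CV-structure on the same holomorphic bundle $K$, and fix a weight $w\in\mathbb Z$. The associated $(TEP)(w)$-structures on the pull-back of $K$ to $\mathbb C\times M$ are given, on smooth sections $a,b$ of $K$, with $X\in T^{1,0}M$ and $U=z\partial_z$, by $$\nabla_Xa=\nabla^r_Xa+\tfrac1zC_Xa,\quad \nabla_{\bar X}a=\bar\partial_{\bar X}a,\quad \nabla_Ua=\bigl(\tfrac1z\mathcal U-\mathcal V+\tfrac w2\bigr)a,\quad P(a,b)=z^wg(a,b),$$ $$\widehat\nabla_Xa=D_Xa+\tfrac1z\widehat C_Xa,\quad \widehat\nabla_{\bar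 X}a=D_{\bar X}a+z\,\kappa\widehat C_X\kappa\,a,\quad \widehat\nabla_Ua=\bigl(\tfrac1z\widehat{\mathcal U}-\mathcal Q+\tfrac w2-z\,\kappa\,\widehat{\mathcal U}\kappa\bigr)a,\quad \widehat P(a,b)=z^w\widehat g(a,b),$$ where $P$ and $\widehat P$ pair the fibre over $z$ with the fibre over $-z$. Assume that both are semisimple, i.e. at every point of $M$ the eigenvalues of $\mathcal U$ are pairwise different, and so are those of $\widehat{\mathcal U}$. For $k\in\{-1,0,1,2,\dots\}\cup\{\infty\}$ the $A(k)$-condition says that there is a formal automorphism $\Psi=\mathrm{id}+zA_1+z^2A_2+\cdots$ with smooth sections $A_i$ of $\mathrm{End}(K)$ such that for all $X\in T^{1,0}M$ and all smooth local sections $a,b$ of $K$ $$\widehat\nabla_X\Psi(a)\equiv\Psi\nabla_Xa,\quad \widehat\nabla_U\Psi(a)\equiv\Psi\nabla_Ua,\quad z^{-w-1}\widehat P(\Psi a,\Psi b)\equiv z^{-w-1}P(a,b)\pmod{z^{k+1}},$$ $$\widehat\nabla_{\bar X}\Psi(a)\equiv\Psi\nabla_{\bar X}a\pmod{z^{k+2}}$$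 (with equality of all coefficients if $k=\infty$). If the $A(-1)$-condition holds, then the $A(k)$-condition holds for every $0\le k\le\infty$. Moreover, in that case the two structures form a harmonic potential real Saito structure: $C=\widehat C$, $\mathcal U=\widehat{\mathcal U}$, $g=\widehat g$, and there is a smooth $g$-symmetric endomorphism $A$ of $K$ with $h$-adjoint $A^\flat$ such that $$D=\nabla^r-[A^\flat,C],\qquad \mathcal Q=\mathcal V-[\mathcal U,A^\flat],\qquad D^{(0,1)}(A^\flat)=\kappa C\kappa .$$ -/

import Mathlib

open Bundle Set
open scoped Manifold ContDiff

namespace TTStar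

noncomputable section

/-! ### Conventions

`M` is a complex manifold modelled on `E` and `K` is a holomorphic vector bundle over `M` with
model fibre `F`.  Sections are functions `∀ x, K x`; their regularity is always required on open
sets only, so that the conditions below are conditions on all local sections.  The underlying real
manifold is `M` with the model `𝓘(ℝ, E)`.  The fibre `T^{1,0}_x M` of the holomorphic tangent bundle
is `TangentSpace 𝓘(ℂ, E) x`. -/

/-- Complex scalar multiplication being continuous, so is real scalar multiplication. -/
instance continuousSMul_real_of_complex (W : Type*) [AddCommGroup W] [Module ℂ W]
    [TopologicalSpace W] [ContinuousSMul ℂ W] : ContinuousSMul ℝ W :=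
  IsScalarTower.continuousSMul ℂ

section Regularity

variable (E : Type*) [NormedAddCommGroup E] [NormedSpace ℂ E]
  {M : Type*} [TopologicalSpace M] [ChartedSpace E M]
  (F : Type*) [NormedAddCommGroup F] [NormedSpace ℂ F]
  {K : M → Type*} [TopologicalSpace (TotalSpace F K)]
  [∀ x, TopologicalSpace (K x)] [FiberBundle F K]

/-- `s` is a `C^∞` section of `K` over `u`. -/
def SmoothOn (s : ∀ x, K x) (u : Set M) : Prop :=
  ContMDiffOn 𝓘(ℝ, E) (𝓘(ℝ, E).prod 𝓘(ℝ, F)) ∞ (fun x => TotalSpace.mk' F x (s x)) u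

/-- `s` is a holomorphic (complex analytic) section of `K` over `u`. -/
def HoloOn (s : ∀ x, K x) (u : Set M) : Prop :=
  ContMDiffOn 𝓘(ℂ, E) (𝓘(ℂ, E).prod 𝓘(ℂ, F)) ω (fun x => TotalSpace.mk' F x (s x)) u

/-- `X` is a holomorphic vector field on `u`. -/
def HoloVectorFieldOn [IsManifold 𝓘(ℂ, E) ω M]
    (X : ∀ x : M, TangentSpace 𝓘(ℂ, E) x) (u : Set M) : Prop :=
  ContMDiffOn 𝓘(ℂ, E) 𝓘(ℂ, E).tangent ω (fun x => (⟨x, X x⟩ : TangentBundle 𝓘(ℂ, E) M)) u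

variable [∀ x, AddCommGroup (K x)] [∀ x, Module ℂ (K x)]

/-- `A` is a `C^∞` section of `End(K)`. -/
def IsSmoothEnd (A : ∀ x, Module.End ℂ (K x)) : Prop :=
  ∀ (u : Set M) (s : ∀ x, K x), IsOpen u → SmoothOn E F s u → SmoothOn E F (fun x => A x (s x)) u

/-- `A` is a holomorphic section of `End(K)`. -/
def IsHoloEnd (A : ∀ x, Module.End ℂ (K x)) : Prop :=
  ∀ (u : Set M) (s : ∀ x, K x), IsOpen u → HoloOn E F s u → HoloOn E F (fun x => A x (s x)) u

end Regularity

/-- The isomorphism `T^{1,0} M ≅ TM` of real vector bundles, `X ↦ X + X̄`.  In a holomorphic chart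
`∑ fⁱ ∂/∂zⁱ` is sent to the real vector with complex coordinates `fⁱ`. -/
def realVector {E : Type*} [NormedAddCommGroup E] [NormedSpace ℂ E]
    {M : Type*} [TopologicalSpace M] [ChartedSpace E M] {x : M}
    (v : TangentSpace 𝓘(ℂ, E) x) : TangentSpace 𝓘(ℝ, E) x := v

section Structures

variable (E : Type*) [NormedAddCommGroup E] [NormedSpace ℂ E]
  {M : Type*} [TopologicalSpace M] [ChartedSpace E M]
  (F : Type*) [NormedAddCommGroup F] [NormedSpace ℂ F]
  (K : M → Type*) [TopologicalSpace (TotalSpace F K)]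
  [∀ x, AddCommGroup (K x)] [∀ x, Module ℂ (K x)] [∀ x, TopologicalSpace (K x)]
  [∀ x, IsTopologicalAddGroup (K x)] [∀ x, ContinuousSMul ℂ (K x)]
  [FiberBundle F K]

/-- A smooth complex linear connection on the complex vector bundle `K`. -/
structure Connection [IsManifold 𝓘(ℂ, E) ω M] extends CovariantDerivative 𝓘(ℝ, E) F K where
  map_I : ∀ (u : Set M) (s : ∀ x, K x), IsOpen u → SmoothOn E F s u →
    ∀ x ∈ u, ∀ v, toFun (fun y => Complex.I • s y) x v = Complex.I • toFun s x v
  smooth : ∀ (u : Set M) (X : ∀ x : M, TangentSpace 𝓘(ℂ, E) x) (s : ∀ x, K x), IsOpen u →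
    HoloVectorFieldOn E X u → SmoothOn E F s u →
    SmoothOn E F (fun x => toFun s x (realVector (X x))) u

variable {E F K}

namespace Connection

variable [IsManifold 𝓘(ℂ, E) ω M]

/-- `D_X s` at `x`, for `X ∈ T^{1,0}_x M`. -/
def d (D : Connection E F K) (s : ∀ x, K x) (x : M) (X : TangentSpace 𝓘(ℂ, E) x) : K x :=
  (1 / 2 : ℂ) • (D.toFun s x (realVector X) - Complex.I • D.toFun s x (realVector (Complex.I • X)))

/-- `D_{X̄} s` at `x`, for `X ∈ T^{1,0}_x M`. -/
def dbar (D : Connection E F K) (s : ∀ x, K x) (x : M) (X : TangentSpace 𝓘(ℂ, E) x) : K x :=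
  (1 / 2 : ℂ) • (D.toFun s x (realVector X) + Complex.I • D.toFun s x (realVector (Complex.I • X)))

/-- The `(0,1)`-part of `D` is the operator `∂̄` of the holomorphic bundle `K`. -/
def IsCompatible (D : Connection E F K) : Prop :=
  ∀ (u : Set M) (s : ∀ x, K x), IsOpen u → HoloOn E F s u → ∀ x ∈ u, ∀ X, D.dbar s x X = 0

/-- `D(g) = 0`, for a complex bilinear form `g` on `K`. -/
def IsMetric (D : Connection E F K) (g : ∀ x, K x →ₗ[ℂ] K x →ₗ[ℂ] ℂ) : Prop :=
  ∀ (u : Set M) (s t : ∀ x, K x), IsOpen u → SmoothOn E F s u → SmoothOn E F t u →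
    ∀ x ∈ u, ∀ v : TangentSpace 𝓘(ℝ, E) x,
      mvfderiv 𝓘(ℝ, E) (fun y => g y (s y) (t y)) x v =
        g x (D.toFun s x v) (t x) + g x (s x) (D.toFun t x v)

/-- `D(h) = 0`, for a sesquilinear form `h` on `K`. -/
def IsHermitian (D : Connection E F K) (h : ∀ x, K x →ₗ[ℂ] K x →ₛₗ[starRingEnd ℂ] ℂ) : Prop :=
  ∀ (u : Set M) (s t : ∀ x, K x), IsOpen u → SmoothOn E F s u → SmoothOn E F t u →
    ∀ x ∈ u, ∀ v : TangentSpace 𝓘(ℝ, E) x,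
      mvfderiv 𝓘(ℝ, E) (fun y => h y (s y) (t y)) x v =
        h x (D.toFun s x v) (t x) + h x (s x) (D.toFun t x v)

/-- `D^{(1,0)}(C) = 0`, that is, `D_X (C_Y) - D_Y (C_X) - C_{[X,Y]} = 0` for holomorphic vector
fields `X`, `Y`. -/
def IsPotential (D : Connection E F K)
    (C : ∀ x, TangentSpace 𝓘(ℂ, E) x →ₗ[ℂ] Module.End ℂ (K x)) : Prop :=
  ∀ (u : Set M) (X Y : ∀ x : M, TangentSpace 𝓘(ℂ, E) x) (s : ∀ x, K x), IsOpen u →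
    HoloVectorFieldOn E X u → HoloVectorFieldOn E Y u → SmoothOn E F s u → ∀ x ∈ u,
      (D.d (fun y => C y (Y y) (s y)) x (X x) - C x (Y x) (D.d s x (X x))) -
        (D.d (fun y => C y (X y) (s y)) x (Y x) - C x (X x) (D.d s x (Y x))) -
        C x (VectorField.mlieBracket 𝓘(ℂ, E) X Y x) (s x) = 0

end Connection

variable (E F K)

/-- The data common to Saito and CV-structures: a Higgs field `C`, a holomorphic endomorphism `U`
and a holomorphic symmetric non-degenerate bilinear form `g` on the holomorphic bundle `K`, with
`C ∧ C = 0`, `[C, U] = 0` and `C`, `U` symmetric with respect to `g`. -/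
structure HiggsData [IsManifold 𝓘(ℂ, E) ω M] where
  C : ∀ x, TangentSpace 𝓘(ℂ, E) x →ₗ[ℂ] Module.End ℂ (K x)
  U : ∀ x, Module.End ℂ (K x)
  g : ∀ x, K x →ₗ[ℂ] K x →ₗ[ℂ] ℂ
  C_holo : ∀ (u : Set M) (X : ∀ x : M, TangentSpace 𝓘(ℂ, E) x) (s : ∀ x, K x), IsOpen u →
    HoloVectorFieldOn E X u → HoloOn E F s u → HoloOn E F (fun x => C x (X x) (s x)) u
  U_holo : IsHoloEnd E F U
  g_holo : ∀ (u : Set M) (s t : ∀ x, K x), IsOpen u → HoloOn E F s u → HoloOn E F t u →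
    ContMDiffOn 𝓘(ℂ, E) 𝓘(ℂ, ℂ) ω (fun x => g x (s x) (t x)) u
  C_comm : ∀ x X Y, C x X * C x Y = C x Y * C x X
  C_comm_U : ∀ x X, C x X * U x = U x * C x X
  g_symm : ∀ x a b, g x a b = g x b a
  g_nondeg : ∀ x a, (∀ b, g x a b = 0) → a = 0
  g_C : ∀ x X a b, g x (C x X a) b = g x a (C x X b)
  g_U : ∀ x a b, g x (U x a) b = g x a (U x b)

/-- A Saito structure `(K → M, C, U, g, ∇ʳ, V)`.  The holomorphic connection `∇ʳ` is extended to
smooth sections by `∂̄`. -/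
structure SaitoStructure [IsManifold 𝓘(ℂ, E) ω M] extends HiggsData E F K where
  conn : Connection E F K
  V : ∀ x, Module.End ℂ (K x)
  conn_compatible : conn.IsCompatible
  conn_holo : ∀ (u : Set M) (X : ∀ x : M, TangentSpace 𝓘(ℂ, E) x) (s : ∀ x, K x), IsOpen u →
    HoloVectorFieldOn E X u → HoloOn E F s u → HoloOn E F (fun x => conn.d s x (X x)) u
  V_holo : IsHoloEnd E F V
  /-- `(∇ʳ)² = 0` -/
  conn_flat : ∀ (u : Set M) (X Y : ∀ x : M, TangentSpace 𝓘(ℂ, E) x) (s : ∀ x, K x), IsOpen u →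
    HoloVectorFieldOn E X u → HoloVectorFieldOn E Y u → HoloOn E F s u → ∀ x ∈ u,
      conn.d (fun y => conn.d s y (Y y)) x (X x) - conn.d (fun y => conn.d s y (X y)) x (Y x) -
        conn.d s x (VectorField.mlieBracket 𝓘(ℂ, E) X Y x) = 0
  /-- `∇ʳ(V) = 0` -/
  V_parallel : ∀ (u : Set M) (s : ∀ x, K x), IsOpen u → SmoothOn E F s u → ∀ x ∈ u, ∀ X,
    conn.d (fun y => V y (s y)) x X - V x (conn.d s x X) = 0
  /-- `∇ʳ(C) = 0` -/
  conn_C : conn.IsPotential C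
  /-- `∇ʳ(U) - [C, V] + C = 0` -/
  conn_U : ∀ (u : Set M) (s : ∀ x, K x), IsOpen u → SmoothOn E F s u → ∀ x ∈ u, ∀ X,
    (conn.d (fun y => U y (s y)) x X - U x (conn.d s x X)) -
      (C x X (V x (s x)) - V x (C x X (s x))) + C x X (s x) = 0
  /-- `∇ʳ(g) = 0` -/
  conn_g : conn.IsMetric g
  V_skew : ∀ x a b, g x (V x a) b + g x a (V x b) = 0

/-- A CV-structure `(K → M, C, U, g, κ, h, D, Q)`. -/
structure CVStructure [IsManifold 𝓘(ℂ, E) ω M] extends HiggsData E F K where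
  /-- the fibrewise antilinear involution -/
  κ : ∀ x, K x →ₛₗ[starRingEnd ℂ] K x
  /-- the hermitian metric, linear in the first and antilinear in the second argument -/
  h : ∀ x, K x →ₗ[ℂ] K x →ₛₗ[starRingEnd ℂ] ℂ
  /-- the Chern connection of `h` -/
  D : Connection E F K
  Q : ∀ x, Module.End ℂ (K x)
  κ_smooth : ∀ (u : Set M) (s : ∀ x, K x), IsOpen u → SmoothOn E F s u →
    SmoothOn E F (fun x => κ x (s x)) u
  κ_invol : ∀ x a, κ x (κ x a) = a
  g_κ : ∀ x a b, g x (κ x a) (κ x b) = starRingEnd ℂ (g x a b)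
  h_eq : ∀ x a b, h x a b = g x a (κ x b)
  h_herm : ∀ x a b, h x a b = starRingEnd ℂ (h x b a)
  h_nondeg : ∀ x a, (∀ b, h x a b = 0) → a = 0
  D_compatible : D.IsCompatible
  D_h : D.IsHermitian h
  /-- `D(κ) = 0` -/
  D_κ : ∀ (u : Set M) (s : ∀ x, K x), IsOpen u → SmoothOn E F s u → ∀ x ∈ u,
    ∀ v : TangentSpace 𝓘(ℝ, E) x, D.toFun (fun y => κ y (s y)) x v = κ x (D.toFun s x v)
  /-- `D^{(1,0)}(C) = 0` -/
  D_C : D.IsPotential C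
  /-- `D^{(1,0)} D^{(0,1)} + D^{(0,1)} D^{(1,0)} = - (C κCκ + κCκ C)`, evaluated on `(X, Ȳ)` for
  holomorphic vector fields `X`, `Y` -/
  D_curv : ∀ (u : Set M) (X Y : ∀ x : M, TangentSpace 𝓘(ℂ, E) x) (s : ∀ x, K x), IsOpen u →
    HoloVectorFieldOn E X u → HoloVectorFieldOn E Y u → SmoothOn E F s u → ∀ x ∈ u,
      D.d (fun y => D.dbar s y (Y y)) x (X x) - D.dbar (fun y => D.d s y (X y)) x (Y x) =
        - (C x (X x) (κ x (C x (Y x) (κ x (s x)))) - κ x (C x (Y x) (κ x (C x (X x) (s x)))))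
  Q_smooth : IsSmoothEnd E F Q
  Q_skew : ∀ x a b, g x (Q x a) b = - g x a (Q x b)
  /-- `D^{(1,0)}(U) - [C, Q] + C = 0` -/
  D_U : ∀ (u : Set M) (s : ∀ x, K x), IsOpen u → SmoothOn E F s u → ∀ x ∈ u, ∀ X,
    (D.d (fun y => U y (s y)) x X - U x (D.d s x X)) -
      (C x X (Q x (s x)) - Q x (C x X (s x))) + C x X (s x) = 0
  /-- `D^{(1,0)}(Q) + [C, κUκ] = 0` -/
  D_Q : ∀ (u : Set M) (s : ∀ x, K x), IsOpen u → SmoothOn E F s u → ∀ x ∈ u, ∀ X,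
    (D.d (fun y => Q y (s y)) x X - Q x (D.d s x X)) +
      (C x X (κ x (U x (κ x (s x)))) - κ x (U x (κ x (C x X (s x))))) = 0
  Q_herm : ∀ x a b, h x (Q x a) b = h x a (Q x b)

/-! ### The associated (TEP)-structures

Near `{0} × M`, a section of `p^*K` is expanded in powers of `z`: a formal Laurent series
`∑ z^j s_j` (`j` bounded below) is given by its coefficients `s : ℤ → ∀ x, K x`.  In these terms the
connections of the (TEP)-structures of weight `w` on `p^*K → ℂ × M` are as follows; `zdz` stands for
the covariant derivative along `z ∂_z`. -/

variable {E F K}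

/-- Coefficients of the constant series `a`. -/
def constSeries {W : Type*} [Zero W] (a : W) : ℤ → W := fun j => if j = 0 then a else 0

section TEP

variable [IsManifold 𝓘(ℂ, E) ω M]

namespace HiggsData

/-- The (TEP)-structure whose endomorphism `U = [z ∇_{z ∂_z}]` on `K = H|_{0 × M}` is the given one
is semisimple: over every point, `U` has as many different eigenvalues as the rank. -/
def IsSemisimple (S : HiggsData E F K) : Prop :=
  ∀ x, {c : ℂ | Module.End.HasEigenvalue (S.U x) c}.ncard = Module.finrank ℂ F

/-- The pairing `P(s, t)(z) = z^w g(s(z), t(-z))` of the (TEP)-structure of weight `w`, at a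
point of `M`. -/
def pairing (S : HiggsData E F K) (w : ℤ) (x : M) (s t : ℤ → K x) : ℤ → ℂ :=
  fun m => ∑ᶠ p : ℤ, (-1 : ℂ) ^ (m - w - p) * S.g x (s p) (t (m - w - p))

end HiggsData

namespace SaitoStructure

/-- `∇_X = ∇ʳ_X + z⁻¹ C_X` -/
def nabla (S : SaitoStructure E F K) (s : ℤ → ∀ x, K x) (x : M)
    (X : TangentSpace 𝓘(ℂ, E) x) : ℤ → K x :=
  fun j => S.conn.d (s j) x X + S.C x X (s (j + 1) x)

/-- `∇_{X̄} = ∂̄_{X̄}` -/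
def nablaBar (S : SaitoStructure E F K) (s : ℤ → ∀ x, K x) (x : M)
    (X : TangentSpace 𝓘(ℂ, E) x) : ℤ → K x :=
  fun j => S.conn.dbar (s j) x X

/-- `∇_{z ∂_z} = z ∂_z + z⁻¹ U - V + w/2` -/
def zdz (S : SaitoStructure E F K) (w : ℤ) (s : ℤ → ∀ x, K x) (x : M) : ℤ → K x :=
  fun j => (j : ℂ) • s j x + S.U x (s (j + 1) x) - S.V x (s j x) + ((w : ℂ) / 2) • s j x

end SaitoStructure

namespace CVStructure

/-- `∇̂_X = D_X + z⁻¹ C_X` -/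
def nabla (T : CVStructure E F K) (s : ℤ → ∀ x, K x) (x : M)
    (X : TangentSpace 𝓘(ℂ, E) x) : ℤ → K x :=
  fun j => T.D.d (s j) x X + T.C x X (s (j + 1) x)

/-- `∇̂_{X̄} = D_{X̄} + z κ C_X κ` -/
def nablaBar (T : CVStructure E F K) (s : ℤ → ∀ x, K x) (x : M)
    (X : TangentSpace 𝓘(ℂ, E) x) : ℤ → K x :=
  fun j => T.D.dbar (s j) x X + T.κ x (T.C x X (T.κ x (s (j - 1) x)))

/-- `∇̂_{z ∂_z} = z ∂_z + z⁻¹ U - Q + w/2 - z κUκ` -/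
def zdz (T : CVStructure E F K) (w : ℤ) (s : ℤ → ∀ x, K x) (x : M) : ℤ → K x :=
  fun j => (j : ℂ) • s j x + T.U x (s (j + 1) x) - T.Q x (s j x) + ((w : ℂ) / 2) • s j x -
    T.κ x (T.U x (T.κ x (s (j - 1) x)))

end CVStructure

end TEP

/-! ### The conditions `A(k)` -/

variable (E F K)

/-- A formal automorphism `Ψ = id + z A₁ + z² A₂ + ⋯` with `Aᵢ ∈ Γ(End K)`. -/
structure FormalAutomorphism where
  A : ℕ → ∀ x, Module.End ℂ (K x)
  A_zero : ∀ x, A 0 x = 1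
  A_smooth : ∀ i, IsSmoothEnd E F (A i)

variable {E F K}

/-- The action of `Ψ` on Laurent series in `z` with coefficients in `K x`. -/
def FormalAutomorphism.act (Ψ : FormalAutomorphism E F K) (x : M) (c : ℤ → K x) : ℤ → K x :=
  fun j => ∑ᶠ i : ℕ, Ψ.A i x (c (j - i))

/-- The action of `Ψ` on Laurent series of sections of `K`. -/
def FormalAutomorphism.actSection (Ψ : FormalAutomorphism E F K) (s : ℤ → ∀ x, K x) :
    ℤ → ∀ x, K x :=
  fun j x => Ψ.act x (fun i => s i x) j

/-- `c ≡ c'` modulo `z^{k+1}`: the coefficients of `z^j` agree for `j ≤ k`. -/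
def EqUpTo {W : Type*} (k : WithTop ℤ) (c c' : ℤ → W) : Prop :=
  ∀ j : ℤ, (j : WithTop ℤ) ≤ k → c j = c' j

variable [IsManifold 𝓘(ℂ, E) ω M]

/-- The `A(k)`-condition (`k = -1, 0, 1, …, ∞`): the (TEP)-structures of weight `w` associated
to the Saito structure `S` and to the CV-structure `T` are formally isomorphic up to order `k`. -/
def ACondition (S : SaitoStructure E F K) (T : CVStructure E F K) (w : ℤ) (k : WithTop ℤ) : Prop :=
  ∃ Ψ : FormalAutomorphism E F K,
    (∀ (u : Set M) (a : ∀ x, K x), IsOpen u → SmoothOn E F a u → ∀ x ∈ u,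
      (∀ X, EqUpTo k (T.nabla (Ψ.actSection (constSeries a)) x X)
        (Ψ.act x (S.nabla (constSeries a) x X))) ∧
      EqUpTo k (T.zdz w (Ψ.actSection (constSeries a)) x)
        (Ψ.act x (S.zdz w (constSeries a) x)) ∧
      (∀ X, EqUpTo (k + 1) (T.nablaBar (Ψ.actSection (constSeries a)) x X)
        (Ψ.act x (S.nablaBar (constSeries a) x X)))) ∧
    (∀ (x : M) (a b : K x),
      EqUpTo k
        (fun j => T.pairing w x (Ψ.act x (constSeries a)) (Ψ.act x (constSeries b)) (j + w + 1))
        (fun j => S.pairing w x (constSeries a) (constSeries b) (j + w + 1)))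

/-- `S` and `T` share the data `(C, U, g)` and form a harmonic potential real Saito structure:
there is a smooth `g`-symmetric endomorphism `A` with `h`-adjoint `A♭` such that
`D = ∇ʳ - [A♭, C]`, `Q = V - [U, A♭]` and `D^{(0,1)}(A♭) = κCκ`. -/
structure IsHarmonicPotential (S : SaitoStructure E F K) (T : CVStructure E F K) : Prop where
  C_eq : S.C = T.C
  U_eq : S.U = T.U
  g_eq : S.g = T.g
  exists_potential : ∃ A Aflat : ∀ x, Module.End ℂ (K x), IsSmoothEnd E F A ∧
    (∀ x a b, T.g x (A x a) b = T.g x a (A x b)) ∧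
    (∀ x a b, T.h x (A x a) b = T.h x a (Aflat x b)) ∧
    (∀ (u : Set M) (s : ∀ x, K x), IsOpen u → SmoothOn E F s u → ∀ x ∈ u, ∀ X,
      T.D.d s x X = S.conn.d s x X - (Aflat x (T.C x X (s x)) - T.C x X (Aflat x (s x))) ∧
      T.D.dbar s x X = S.conn.dbar s x X ∧
      T.D.dbar (fun y => Aflat y (s y)) x X - Aflat x (T.D.dbar s x X) =
        T.κ x (T.C x X (T.κ x (s x)))) ∧
    (∀ x, T.Q x = S.V x - (T.U x * Aflat x - Aflat x * T.U x))

end Structures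

end

end TTStar

/-! The condition at order $-1$ is used only to identify data: its lowest coefficients give
$C=\widehat C$, $\mathcal U=\widehat{\mathcal U}$, $g=\widehat g$ and $D^{(0,1)}=\bar\partial$
(`ACondition.higgs_eq`), and its automorphism is then discarded. One new automorphism
$\Psi=1+zA_1+\cdots$ is built that serves all orders at once.

$\Psi$ is determined by the equation along $z\partial_z$ alone, in which the weight cancels:
$[\mathcal U,A_{j+1}]+jA_j-\mathcal QA_j+A_j\mathcal V-\kappa\,\mathcal U\kappa A_{j-1}=0$. As
$\mathcal U$ has simple spectrum, $[\mathcal U,B]=R$ is solvable exactly when $R$ has zero diagonal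
in an eigenbasis, and then only the diagonal of $B$ is free. Skew endomorphisms have zero diagonal,
so the next solvability condition fixes that diagonal through the factor $j\ne0$; at the start it
reads $(\mathcal V-\mathcal Q)_{ii}=0$, which holds by skewness (`exists_intertwines`). The same
argument gives uniqueness: an intertwiner whose coefficients of $z^{-1}$ and $z^0$ vanish has no
positive coefficients either (`Intertwines.eq_zero`). The coefficients are smooth because each
solves an injective linear system with smooth entries (`isSmoothEnd_of_commutator_eq`).

The remaining equations follow from uniqueness. The defects $\widehat\nabla_X\Psi-\Psi\nabla_X$ and
$\widehat\nabla_{\bar X}\Psi-\Psi\nabla_{\bar X}$ are tensorial, and they intertwine the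
$z\partial_z$-equations because these commute with the horizontal derivatives
(`intertwines_gaugeDefect`). Their $z^{-1}$-coefficients vanish, and their $z^0$-coefficients
commute with $\mathcal U$ and have zero diagonal, so the defects are zero. For the pairing, the
$g$-adjoint of $\Psi(-z)$ composed with $\Psi(z)$ is an intertwiner with constant term $1$, hence
equal to $1$ (`Intertwines.isometry`). Finally $A^\flat=-A_1$, and the three potential equations are
single coefficients of the equations for $\Psi$. -/

namespace TTStar

noncomputable section

/-! ### The smooth real bundle underlying a holomorphic bundle; local sections. -/

section RealBundle

set_option linter.unusedSectionVars false

variable {E : Type*} [NormedAddCommGroup E] [NormedSpace ℂ E]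
  {M : Type*} [TopologicalSpace M] [ChartedSpace E M]
  {F : Type*} [NormedAddCommGroup F] [NormedSpace ℂ F]

/-- A holomorphic map to a complex normed space is smooth. -/
theorem contMDiffWithinAt_real_of_complex {W : Type*} [NormedAddCommGroup W] [NormedSpace ℂ W]
    {n m : WithTop ℕ∞} (hnm : m ≤ n) {f : M → W} {u : Set M} {x : M}
    (hf : ContMDiffWithinAt 𝓘(ℂ, E) 𝓘(ℂ, W) n f u x) :
    ContMDiffWithinAt 𝓘(ℝ, E) 𝓘(ℝ, W) m f u x := by
  rw [contMDiffWithinAt_iff] at hf ⊢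
  exact ⟨hf.1, (hf.2.restrict_scalars ℝ).of_le hnm⟩

variable {K : M → Type*} [TopologicalSpace (TotalSpace F K)]
  [∀ x, AddCommGroup (K x)] [∀ x, Module ℂ (K x)] [∀ x, TopologicalSpace (K x)]
  [FiberBundle F K] [VectorBundle ℂ F K]

theorem trivialization_isLinear_real (e : Trivialization F (π F K)) [MemTrivializationAtlas e] :
    e.IsLinear ℝ where
  linear x hx :=
    { map_add := (e.linear ℂ hx).map_add
      map_smul := fun c v => by
        have h := (e.linear ℂ hx).map_smul (c : ℂ) v
        simpa only [Complex.coe_smul] using h }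

/-- The real vector bundle underlying a complex vector bundle. -/
instance vectorBundle_real : VectorBundle ℝ F K where
  trivialization_linear' e _ := trivialization_isLinear_real e
  continuousOn_coordChange' e e' _ _ := by
    have := trivialization_isLinear_real e
    have := trivialization_isLinear_real e'
    have h := VectorBundle.continuousOn_coordChange' (R := ℂ) e e'
    refine ((ContinuousLinearMap.restrictScalarsL ℂ F F ℝ ℝ).continuous.comp_continuousOn h).congr
      fun x hx => ?_
    ext v
    simp [Trivialization.coordChangeL_apply _ _ hx]

/-- The smooth real vector bundle underlying a holomorphic vector bundle. -/
instance contMDiffVectorBundle_real [ContMDiffVectorBundle ω F K 𝓘(ℂ, E)] :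
    ContMDiffVectorBundle ∞ F K 𝓘(ℝ, E) where
  contMDiffOn_coordChangeL e e' _ _ := by
    have h := ContMDiffVectorBundle.contMDiffOn_coordChangeL (n := ω) (IB := 𝓘(ℂ, E)) e e'
    have h2 : ContMDiffOn 𝓘(ℝ, E) 𝓘(ℝ, F →L[ℂ] F) ∞
        (fun b : M => (e.coordChangeL ℂ e' b : F →L[ℂ] F)) (e.baseSet ∩ e'.baseSet) :=
      fun x hx => contMDiffWithinAt_real_of_complex (by simp) (h x hx)
    refine ((ContinuousLinearMap.restrictScalarsL ℂ F F ℝ ℝ).contMDiff.comp_contMDiffOn h2).congr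
      fun x hx => ?_
    ext v
    simp [Trivialization.coordChangeL_apply _ _ hx]

variable [ContMDiffVectorBundle ω F K 𝓘(ℂ, E)]

theorem smoothOn_iff (s : ∀ x, K x) {u : Set M} (hu : IsOpen u)
    (e : Trivialization F (π F K)) [MemTrivializationAtlas e] (hue : u ⊆ e.baseSet) :
    SmoothOn E F s u ↔ ContMDiffOn 𝓘(ℝ, E) 𝓘(ℝ, F) ∞ (fun x => (e ⟨x, s x⟩).2) u :=
  e.contMDiffOn_section_iff hu hue

theorem holoOn_iff (s : ∀ x, K x) {u : Set M} (hu : IsOpen u)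
    (e : Trivialization F (π F K)) [MemTrivializationAtlas e] (hue : u ⊆ e.baseSet) :
    HoloOn E F s u ↔ ContMDiffOn 𝓘(ℂ, E) 𝓘(ℂ, F) ω (fun x => (e ⟨x, s x⟩).2) u :=
  e.contMDiffOn_section_iff hu hue

theorem SmoothOn.mono {s : ∀ x, K x} {u v : Set M} (h : SmoothOn E F s u) (hvu : v ⊆ u) :
    SmoothOn E F s v :=
  ContMDiffOn.mono h hvu

/-- Smoothness on an open set may be checked on neighbourhoods of its points. -/
theorem smoothOn_of_locally {s : ∀ x, K x} {u : Set M}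
    (h : ∀ x ∈ u, ∃ v, IsOpen v ∧ x ∈ v ∧ SmoothOn E F s v) : SmoothOn E F s u := by
  intro x hx
  obtain ⟨v, hv, hxv, hs⟩ := h x hx
  exact (ContMDiffOn.contMDiffAt hs (hv.mem_nhds hxv)).contMDiffWithinAt

theorem smoothOn_of_holoOn {s : ∀ x, K x} {u : Set M} (hu : IsOpen u) (h : HoloOn E F s u) :
    SmoothOn E F s u := by
  refine smoothOn_of_locally fun x hx => ?_
  let e := trivializationAt F K x
  have hv : IsOpen (u ∩ e.baseSet) := hu.inter e.open_baseSet
  refine ⟨u ∩ e.baseSet, hv, ⟨hx, FiberBundle.mem_baseSet_trivializationAt F K x⟩, ?_⟩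
  rw [smoothOn_iff s hv e inter_subset_right]
  have h' : HoloOn E F s (u ∩ e.baseSet) := ContMDiffOn.mono h inter_subset_left
  rw [holoOn_iff s hv e inter_subset_right] at h'
  exact fun y hy => contMDiffWithinAt_real_of_complex (by simp) (h' y hy)

theorem SmoothOn.add {s t : ∀ x, K x} {u : Set M} (hs : SmoothOn E F s u)
    (ht : SmoothOn E F t u) : SmoothOn E F (s + t) u :=
  ContMDiffOn.add_section hs ht

theorem SmoothOn.sub {s t : ∀ x, K x} {u : Set M} (hs : SmoothOn E F s u)
    (ht : SmoothOn E F t u) : SmoothOn E F (s - t) u :=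
  ContMDiffOn.sub_section hs ht

theorem SmoothOn.smul {s : ∀ x, K x} {u : Set M} {f : M → ℝ}
    (hf : ContMDiffOn 𝓘(ℝ, E) 𝓘(ℝ, ℝ) ∞ f u) (hs : SmoothOn E F s u) :
    SmoothOn E F (f • s) u :=
  ContMDiffOn.smul_section hf hs

theorem smoothOn_zero (u : Set M) : SmoothOn E F (0 : ∀ x, K x) u :=
  contMDiffOn_zeroSection ℝ K

/-- The section of `K` which is constant in the trivialization `e`. -/
def constExtension (e : Trivialization F (π F K)) [e.IsLinear ℂ] (v : F) : ∀ x, K x :=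
  fun x => e.symmₗ ℂ x v

theorem apply_constExtension (e : Trivialization F (π F K)) [e.IsLinear ℂ] (v : F)
    {x : M} (hx : x ∈ e.baseSet) : (e ⟨x, constExtension e v x⟩).2 = v := by
  simp [constExtension, e.coe_symmₗ hx, e.apply_mk_symm hx]

theorem holoOn_constExtension (e : Trivialization F (π F K)) [MemTrivializationAtlas e] (v : F) :
    HoloOn E F (constExtension e v) e.baseSet := by
  rw [holoOn_iff _ e.open_baseSet e subset_rfl]
  exact contMDiffOn_const.congr fun x hx => apply_constExtension e v hx

theorem smoothOn_constExtension (e : Trivialization F (π F K)) [MemTrivializationAtlas e] (v : F) :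
    SmoothOn E F (constExtension e v) e.baseSet :=
  smoothOn_of_holoOn e.open_baseSet (holoOn_constExtension e v)

variable (E F) in
/-- Through every point of `K` passes a local holomorphic section. -/
theorem exists_holoOn_eq (x : M) (v : K x) :
    ∃ (u : Set M) (s : ∀ x, K x), IsOpen u ∧ x ∈ u ∧ HoloOn E F s u ∧ s x = v := by
  let e := trivializationAt F K x
  have hx : x ∈ e.baseSet := FiberBundle.mem_baseSet_trivializationAt F K x
  refine ⟨e.baseSet, constExtension e (e ⟨x, v⟩).2, e.open_baseSet, hx,
    holoOn_constExtension e _, ?_⟩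
  simp [constExtension, e.coe_symmₗ hx, e.symm_apply_apply_mk hx]

end RealBundle

end

end TTStar
namespace TTStar

noncomputable section

/-! ### Commutator equations for an endomorphism with simple spectrum. -/

section LinearAlgebra

open Module

variable {V : Type*} [AddCommGroup V] [Module ℂ V]

/-- `R` is orthogonal to the powers of `U` with respect to the trace form. -/
def TraceOrth (U R : Module.End ℂ V) : Prop :=
  ∀ k : Fin (finrank ℂ V), LinearMap.trace ℂ V (U ^ (k : ℕ) * R) = 0

theorem TraceOrth.add {U R R' : Module.End ℂ V} (h : TraceOrth U R) (h' : TraceOrth U R') :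
    TraceOrth U (R + R') := fun k => by rw [mul_add, map_add, h k, h' k, add_zero]

theorem TraceOrth.neg {U R : Module.End ℂ V} (h : TraceOrth U R) : TraceOrth U (-R) :=
  fun k => by rw [mul_neg, map_neg, h k, neg_zero]

/-- Cyclicity of the trace, since $W$ commutes with all powers of $U$. It is needed for $W=U$ and
for $W=C_X$. -/
theorem traceOrth_commutator {U W : Module.End ℂ V} (hW : Commute U W) (B : Module.End ℂ V) :
    TraceOrth U (W * B - B * W) := fun k => by
  have h : U ^ (k : ℕ) * W = W * U ^ (k : ℕ) := (hW.pow_left _).eq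
  rw [mul_sub, map_sub, ← mul_assoc, h, mul_assoc, LinearMap.trace_mul_comm, mul_assoc, sub_self]

/-- An endomorphism of an `n`-dimensional space with `n` eigenvalues has an eigenbasis. -/
theorem exists_eigenbasis [FiniteDimensional ℂ V] {U : Module.End ℂ V}
    (hU : {c : ℂ | Module.End.HasEigenvalue U c}.ncard = finrank ℂ V) :
    ∃ (b : Basis (Fin (finrank ℂ V)) ℂ V) (u : Fin (finrank ℂ V) → ℂ),
      Function.Injective u ∧ ∀ i, U (b i) = u i • b i := by
  have hfin : {c : ℂ | Module.End.HasEigenvalue U c}.Finite :=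
    Module.End.finite_hasEigenvalue U
  obtain ⟨e⟩ : Nonempty (Fin (finrank ℂ V) ≃ {c : ℂ | Module.End.HasEigenvalue U c}) := by
    have := hfin.fintype
    refine ⟨(Fintype.equivFinOfCardEq ?_).symm⟩
    rw [← hU, Set.ncard_eq_toFinset_card', Set.toFinset_card]
  choose v hv using fun i => (e i).2.exists_hasEigenvector
  have hinj : Function.Injective fun i => (e i : ℂ) := Subtype.val_injective.comp e.injective
  have hli : LinearIndependent ℂ v :=
    Module.End.eigenvectors_linearIndependent' U (fun i => (e i : ℂ)) hinj v hv
  refine ⟨basisOfLinearIndependentOfCardEqFinrank' v hli (by simp), fun i => e i, hinj,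
    fun i => ?_⟩
  simpa using (hv i).apply_eq_smul

/-- `U` is symmetric for the non-degenerate symmetric form `g` and has simple spectrum. -/
structure SimpleSymmetric (g : V →ₗ[ℂ] V →ₗ[ℂ] ℂ) (U : Module.End ℂ V) : Prop where
  card : {c : ℂ | Module.End.HasEigenvalue U c}.ncard = finrank ℂ V
  g_symm : ∀ a b, g a b = g b a
  g_nondeg : ∀ a, (∀ b, g a b = 0) → a = 0
  g_U : ∀ a b, g (U a) b = g a (U b)

/-- `Q` is skew-symmetric for `g`. -/
def IsSkew (g : V →ₗ[ℂ] V →ₗ[ℂ] ℂ) (Q : Module.End ℂ V) : Prop :=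
  ∀ a b, g (Q a) b = - g a (Q b)

section Eigenbasis

variable {n : ℕ} (b : Basis (Fin n) ℂ V) {u : Fin n → ℂ} {U : Module.End ℂ V}

theorem toMatrix_eigenbasis (hU : ∀ i, U (b i) = u i • b i) :
    LinearMap.toMatrixAlgEquiv b U = Matrix.diagonal u := by
  ext i k
  rw [LinearMap.toMatrixAlgEquiv_apply, hU, map_smul, Basis.repr_self, Matrix.diagonal_apply]
  by_cases h : i = k <;> simp [h]

theorem toMatrix_commutator (hU : ∀ i, U (b i) = u i • b i) (B : Module.End ℂ V) (i k : Fin n) :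
    LinearMap.toMatrixAlgEquiv b (U * B - B * U) i k =
      (u i - u k) * LinearMap.toMatrixAlgEquiv b B i k := by
  rw [map_sub, map_mul, map_mul, toMatrix_eigenbasis b hU, Matrix.sub_apply,
    Matrix.diagonal_mul, Matrix.mul_diagonal]
  ring

theorem trace_pow_mul (hU : ∀ i, U (b i) = u i • b i) (R : Module.End ℂ V) (k : ℕ) :
    LinearMap.trace ℂ V (U ^ k * R) = ∑ i, u i ^ k * LinearMap.toMatrixAlgEquiv b R i i := by
  have h : LinearMap.trace ℂ V (U ^ k * R) =
      (LinearMap.toMatrixAlgEquiv b (U ^ k * R)).trace :=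
    LinearMap.trace_eq_matrix_trace ℂ b _
  rw [h, map_mul, map_pow, toMatrix_eigenbasis b hU, Matrix.diagonal_pow, Matrix.trace]
  simp [Matrix.diagonal_mul]

/-- The traces against $U^k$ form the Vandermonde system of the eigenvalues applied to the diagonal
of $R$. So `TraceOrth` says "zero diagonal in an eigenbasis" without choosing one, by conditions
polynomial in the entries of $U$ and $R$; this is what makes smooth dependence on the point
accessible. -/
theorem traceOrth_iff (b : Basis (Fin (finrank ℂ V)) ℂ V) {u : Fin (finrank ℂ V) → ℂ}
    (hu : Function.Injective u) (hU : ∀ i, U (b i) = u i • b i) (R : Module.End ℂ V) :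
    TraceOrth U R ↔ ∀ i, LinearMap.toMatrixAlgEquiv b R i i = 0 := by
  constructor
  · intro h
    refine fun i => congrFun (Matrix.eq_zero_of_forall_pow_sum_mul_pow_eq_zero
      (v := fun i => LinearMap.toMatrixAlgEquiv b R i i) hu fun k => ?_) i
    rw [← h k, trace_pow_mul b hU]
    exact Finset.sum_congr rfl fun _ _ => mul_comm _ _
  · intro h k
    rw [trace_pow_mul b hU]
    exact Finset.sum_eq_zero fun i _ => by rw [h i, mul_zero]

/-- Eigenvectors of the symmetric $U$ for different eigenvalues are orthogonal, so $g(b_i,b_i)\ne0$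
by non-degeneracy. Skewness gives $g(Qb_i,b_i)=0$, and this number is $Q_{ii}\,g(b_i,b_i)$. -/
theorem IsSkew.diag_eq_zero {g : V →ₗ[ℂ] V →ₗ[ℂ] ℂ} (hg : SimpleSymmetric g U)
    (hu : Function.Injective u) (hU : ∀ i, U (b i) = u i • b i) {Q : Module.End ℂ V}
    (hQ : IsSkew g Q) (i : Fin n) : LinearMap.toMatrixAlgEquiv b Q i i = 0 := by
  have horth : ∀ i k, k ≠ i → g (b k) (b i) = 0 := fun i k hik => by
    have h := hg.g_U (b k) (b i)
    rw [hU, hU, map_smul, map_smul, LinearMap.smul_apply, smul_eq_mul, smul_eq_mul] at h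
    exact (mul_eq_mul_right_iff.mp h).resolve_left fun h' => hik (hu h')
  have hne : g (b i) (b i) ≠ 0 := fun h0 => b.ne_zero i <| hg.g_nondeg _ fun c => by
    rw [← b.sum_repr c, map_sum]
    refine Finset.sum_eq_zero fun k _ => ?_
    rw [map_smul]
    by_cases hk : k = i
    · rw [hk, h0, smul_zero]
    · rw [horth k i (Ne.symm hk), smul_zero]
  have hval : g (Q (b i)) (b i) = LinearMap.toMatrixAlgEquiv b Q i i * g (b i) (b i) := by
    conv_lhs => rw [← b.sum_repr (Q (b i))]
    rw [map_sum, LinearMap.sum_apply, Finset.sum_eq_single i]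
    · rw [map_smul, LinearMap.smul_apply, smul_eq_mul, LinearMap.toMatrixAlgEquiv_apply]
    · intro k _ hk
      rw [map_smul, LinearMap.smul_apply, horth i k hk, smul_zero]
    · simp
  have h := hQ (b i) (b i)
  rw [hg.g_symm (b i), hval] at h
  have h2 : LinearMap.toMatrixAlgEquiv b Q i i * g (b i) (b i) = 0 := by linear_combination h / 2
  exact (mul_eq_zero.mp h2).resolve_right hne

end Eigenbasis

variable [FiniteDimensional ℂ V] {g : V →ₗ[ℂ] V →ₗ[ℂ] ℂ} {U : Module.End ℂ V}

theorem IsSkew.traceOrth (hg : SimpleSymmetric g U) {Q : Module.End ℂ V} (hQ : IsSkew g Q) :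
    TraceOrth U Q := by
  obtain ⟨b, u, hu, hU⟩ := exists_eigenbasis hg.card
  exact (traceOrth_iff b hu hU Q).2 (hQ.diag_eq_zero b hg hu hU)

/-- Commuting with $U$ makes $B$ diagonal in the eigenbasis, and trace orthogonality kills the
diagonal. -/
theorem eq_zero_of_commute_of_traceOrth (hg : SimpleSymmetric g U) {B : Module.End ℂ V}
    (hB : U * B - B * U = 0) (h : TraceOrth U B) : B = 0 := by
  obtain ⟨b, u, hu, hU⟩ := exists_eigenbasis hg.card
  rw [traceOrth_iff b hu hU] at h
  apply (LinearMap.toMatrixAlgEquiv b).injective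
  ext i k
  rw [map_zero, Matrix.zero_apply]
  by_cases hik : i = k
  · rw [← hik, h]
  · have h1 := toMatrix_commutator b hU B i k
    rw [hB, map_zero, Matrix.zero_apply] at h1
    exact (mul_eq_zero.mp h1.symm).resolve_left fun h' => hik (hu (sub_eq_zero.mp h'))

/-- This is why the skew terms do not see the free diagonal part in the recursion. -/
theorem diag_mul_of_offDiag {n : ℕ} {X Y : Matrix (Fin n) (Fin n) ℂ}
    (hY : ∀ i k, i ≠ k → Y i k = 0) (hX : ∀ i, X i i = 0) (i : Fin n) :
    (X * Y) i i = 0 ∧ (Y * X) i i = 0 := by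
  rw [Matrix.mul_apply, Matrix.mul_apply]
  constructor <;> refine Finset.sum_eq_zero fun k _ => ?_ <;> by_cases h : k = i
  · rw [h, hX, zero_mul]
  · rw [hY k i h, mul_zero]
  · rw [h, hX, mul_zero]
  · rw [hY i k (Ne.symm h), zero_mul]

/-- Here $B$ is diagonal in the eigenbasis, while $Q$ and $Q'$ have zero diagonal; the diagonal of
$cB-QB+BQ'$ is therefore that of $cB$. This is the uniqueness half of one step of the recursion. -/
theorem eq_zero_of_commute_of_traceOrth_smul (hg : SimpleSymmetric g U)
    {B Q Q' : Module.End ℂ V} (hQ : IsSkew g Q) (hQ' : IsSkew g Q') {c : ℂ} (hc : c ≠ 0)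
    (hB : U * B - B * U = 0) (h : TraceOrth U (c • B - Q * B + B * Q')) : B = 0 := by
  refine eq_zero_of_commute_of_traceOrth hg hB ?_
  obtain ⟨b, u, hu, hU⟩ := exists_eigenbasis hg.card
  rw [traceOrth_iff b hu hU] at h ⊢
  have hoff : ∀ i k, i ≠ k → LinearMap.toMatrixAlgEquiv b B i k = 0 := fun i k hik => by
    have h1 := toMatrix_commutator b hU B i k
    rw [hB, map_zero, Matrix.zero_apply] at h1
    exact (mul_eq_zero.mp h1.symm).resolve_left fun h' => hik (hu (sub_eq_zero.mp h'))
  intro i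
  have h1 := h i
  rw [map_add, map_sub, map_mul, map_mul, map_smul, Matrix.add_apply, Matrix.sub_apply,
    (diag_mul_of_offDiag hoff (hQ.diag_eq_zero b hg hu hU) i).1,
    (diag_mul_of_offDiag hoff (hQ'.diag_eq_zero b hg hu hU) i).2, sub_zero, add_zero,
    Matrix.smul_apply, smul_eq_mul] at h1
  exact (mul_eq_zero.mp h1).resolve_left hc

/-- The existence half of one step of the recursion: the first equation fixes the off-diagonal
entries of $B$, and the second, which is the solvability condition of the following step, fixes the
diagonal. -/
theorem exists_commutator_eq (hg : SimpleSymmetric g U)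
    {Q Q' : Module.End ℂ V} (hQ : IsSkew g Q) (hQ' : IsSkew g Q') {c : ℂ} (hc : c ≠ 0)
    {R : Module.End ℂ V} (hR : TraceOrth U R) (S : Module.End ℂ V) :
    ∃ B : Module.End ℂ V, U * B - B * U = R ∧ TraceOrth U (c • B - Q * B + B * Q' - S) := by
  obtain ⟨b, u, hu, hU⟩ := exists_eigenbasis hg.card
  rw [traceOrth_iff b hu hU] at hR
  let φ := LinearMap.toMatrixAlgEquiv b
  -- On the diagonal the quotient has denominator $0$ and hence the value $0$, so $B_0$ has zero
  -- diagonal.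
  let B₀ : Matrix (Fin (finrank ℂ V)) (Fin (finrank ℂ V)) ℂ :=
    fun i k => φ R i k / (u i - u k)
  -- The diagonal of $cB-QB+BQ'-S$ is $c\,d_i$ plus a contribution of $B_0$; $d$ is the solution of
  -- its vanishing.
  let d : Fin (finrank ℂ V) → ℂ := fun i => (φ S - (- (φ Q * B₀) + B₀ * φ Q')) i i / c
  let Δ : Matrix (Fin (finrank ℂ V)) (Fin (finrank ℂ V)) ℂ := Matrix.diagonal d
  have hΔ : ∀ i k, i ≠ k → Δ i k = 0 := fun i k h => Matrix.diagonal_apply_ne d h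
  refine ⟨φ.symm (B₀ + Δ), ?_, ?_⟩
  · apply φ.injective
    ext i k
    rw [toMatrix_commutator b hU]
    change _ * φ (φ.symm _) i k = _
    rw [AlgEquiv.apply_symm_apply, Matrix.add_apply]
    by_cases hik : i = k
    · rw [← hik, sub_self, zero_mul]
      exact (hR i).symm
    · rw [hΔ i k hik, add_zero]
      exact mul_div_cancel₀ _ (sub_ne_zero.2 fun h => hik (hu h))
  · rw [traceOrth_iff b hu hU]
    intro i
    change φ _ i i = 0
    rw [map_sub, map_add, map_sub, map_mul, map_mul, map_smul, AlgEquiv.apply_symm_apply,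
      mul_add, add_mul]
    have h1 := diag_mul_of_offDiag hΔ (hQ.diag_eq_zero b hg hu hU) i
    have h2 := diag_mul_of_offDiag hΔ (hQ'.diag_eq_zero b hg hu hU) i
    have h3 : B₀ i i = 0 := by simp [B₀]
    have h4 : c * Δ i i = (φ S - (- (φ Q * B₀) + B₀ * φ Q')) i i := by
      have h5 : Δ i i = d i := Matrix.diagonal_apply_eq d i
      rw [h5]
      exact mul_div_cancel₀ _ hc
    simp only [Matrix.sub_apply, Matrix.add_apply, Matrix.smul_apply, Matrix.neg_apply,
      smul_eq_mul] at h4 ⊢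
    have h1' : (φ Q * Δ) i i = 0 := h1.1
    have h2' : (Δ * φ Q') i i = 0 := h2.2
    linear_combination h4 + c * h3 - h1' + h2'

end LinearAlgebra

end

end TTStar
namespace TTStar

noncomputable section

/-! ### Formal intertwiners at a point: uniqueness, existence, composition, isometry. -/

section FormalSeries

set_option linter.unusedSectionVars false

open Module

variable {V : Type*} [AddCommGroup V] [Module ℂ V]

/-- Extension by zero of a sequence to negative indices. -/
def extendZero {W : Type*} [Zero W] (A : ℕ → W) : ℤ → W := fun j =>
  if 0 ≤ j then A j.toNat else 0

@[simp]
theorem extendZero_natCast {W : Type*} [Zero W] (A : ℕ → W) (n : ℕ) :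
    extendZero A (n : ℤ) = A n := by simp [extendZero]

theorem extendZero_of_neg {W : Type*} [Zero W] (A : ℕ → W) {j : ℤ} (hj : j < 0) :
    extendZero A j = 0 := if_neg (not_le.2 hj)

/-- The Laurent series `∑ z^j T_j` satisfies
`(z ∂_z + z⁻¹ U - Q - z S) ∘ T = T ∘ (z ∂_z + z⁻¹ U - Q' - z S')`. -/
def Intertwines (U Q Q' S S' : Module.End ℂ V) (T : ℤ → Module.End ℂ V) : Prop :=
  ∀ j : ℤ, U * T (j + 1) - T (j + 1) * U + (j : ℂ) • T j - Q * T j + T j * Q' -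
    S * T (j - 1) + T (j - 1) * S' = 0

variable [FiniteDimensional ℂ V] {g : V →ₗ[ℂ] V →ₗ[ℂ] ℂ} {U Q Q' S S' : Module.End ℂ V}

/-- A formal intertwiner without constant term vanishes. -/
theorem Intertwines.eq_zero (hg : SimpleSymmetric g U) (hQ : IsSkew g Q) (hQ' : IsSkew g Q')
    {T : ℤ → Module.End ℂ V} (hT : Intertwines U Q Q' S S' T) (hneg : T (-1) = 0) (h0 : T 0 = 0)
    (n : ℕ) : T n = 0 := by
  suffices h : ∀ n : ℕ, T ((n : ℤ) - 1) = 0 ∧ T n = 0 from (h n).2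
  intro n
  induction n with
  | zero => exact ⟨by simpa using hneg, by simpa using h0⟩
  | succ n ih =>
    -- Relation $n$ says that $T_{n+1}$ commutes with $U$. Relation $n+1$ says that
    -- $(n+1)T_{n+1}-QT_{n+1}+T_{n+1}Q'$ is a commutator with $U$, hence trace orthogonal.
    have h1 := hT n
    have h2 := hT (n + 1)
    rw [ih.1, ih.2] at h1
    rw [show (n : ℤ) + 1 - 1 = n by ring, ih.2] at h2
    refine ⟨by rw [show ((n + 1 : ℕ) : ℤ) - 1 = n by push_cast; ring]; exact ih.2, ?_⟩
    rw [show ((n + 1 : ℕ) : ℤ) = (n : ℤ) + 1 by push_cast; ring]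
    have hc : (((n : ℤ) + 1 : ℤ) : ℂ) ≠ 0 := by exact_mod_cast Nat.succ_ne_zero n
    refine eq_zero_of_commute_of_traceOrth_smul hg hQ hQ' hc (by simpa using h1) ?_
    have h3 : (((n : ℤ) + 1 : ℤ) : ℂ) • T (n + 1) - Q * T (n + 1) + T (n + 1) * Q' =
        -(U * T (n + 1 + 1) - T (n + 1 + 1) * U) := by
      rw [mul_zero, zero_mul, sub_zero, add_zero] at h2
      rw [eq_neg_iff_add_eq_zero, ← h2]
      abel
    rw [h3]
    exact (traceOrth_commutator (Commute.refl U) _).neg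

/-- There is a formal intertwiner with constant term `1`. -/
theorem exists_intertwines (hg : SimpleSymmetric g U) (hQ : IsSkew g Q) (hQ' : IsSkew g Q')
    (S S' : Module.End ℂ V) :
    ∃ A : ℕ → Module.End ℂ V, A 0 = 1 ∧ Intertwines U Q Q' S S' (extendZero A) := by
  -- The part of relation $n$ that involves only $p=(A_{n-1},A_n)$, so that $A_{n+1}$ must satisfy
  -- $[U,A_{n+1}]=-\mathrm{rem}$. The recursion runs on pairs carrying the solvability condition
  -- `TraceOrth U (rem n p)`.
  let rem : ℕ → Module.End ℂ V × Module.End ℂ V → Module.End ℂ V := fun n p =>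
    (n : ℂ) • p.2 - Q * p.2 + p.2 * Q' - S * p.1 + p.1 * S'
  have hstep : ∀ (n : ℕ) (p : {p : Module.End ℂ V × Module.End ℂ V // TraceOrth U (rem n p)}),
      ∃ B : Module.End ℂ V, U * B - B * U = - rem n p ∧ TraceOrth U (rem (n + 1) (p.1.2, B)) :=
    fun n p => by
      simpa only [rem, ← sub_sub_eq_add_sub, sub_sub_eq_add_sub, sub_add] using
        exists_commutator_eq hg hQ hQ' (Nat.cast_ne_zero.2 n.succ_ne_zero) p.2.neg
          (S * p.1.2 - p.1.2 * S')
  choose B hB hB' using hstep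
  -- At the start the remainder is $Q'-Q$, which is skew.
  have h0 : TraceOrth U (rem 0 (0, 1)) := by
    have := (hQ'.traceOrth hg).add (hQ.traceOrth hg).neg
    simpa [rem, neg_add_eq_sub, sub_eq_add_neg, add_comm] using this
  let st : ∀ n : ℕ, {p : Module.End ℂ V × Module.End ℂ V // TraceOrth U (rem n p)} := fun n =>
    Nat.rec ⟨(0, 1), h0⟩ (fun n p => ⟨(p.1.2, B n p), hB' n p⟩) n
  have hst : ∀ n, (st n).1.1 = extendZero (fun k => (st k).1.2) ((n : ℤ) - 1) := by
    intro n
    cases n with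
    | zero => rw [extendZero_of_neg _ (by simp)]; rfl
    | succ n =>
      rw [show ((n + 1 : ℕ) : ℤ) - 1 = n by push_cast; ring, extendZero_natCast]
  refine ⟨fun n => (st n).1.2, rfl, fun j => ?_⟩
  rcases lt_or_ge j 0 with hj | hj
  · rw [extendZero_of_neg _ hj, extendZero_of_neg _ (show j - 1 < 0 by lia)]
    -- The relation at $j=-1$ is $[U,1]=0$; below it all terms are zero.
    rcases eq_or_ne j (-1) with rfl | hj'
    · have : extendZero (fun n => (st n).1.2) (-1 + 1) = 1 := rfl
      rw [this]
      simp
    · rw [extendZero_of_neg _ (show j + 1 < 0 by lia)]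
      simp
  · obtain ⟨n, rfl⟩ := Int.eq_ofNat_of_zero_le hj
    rw [← hst, extendZero_natCast, show (n : ℤ) + 1 = ((n + 1 : ℕ) : ℤ) by push_cast; ring,
      extendZero_natCast]
    have h := hB n (st n)
    change U * B n (st n) - B n (st n) * U + _ • (st n).1.2 - _ + _ - _ + _ = 0
    rw [h]
    simp only [rem, Int.cast_natCast]
    abel

/-- The derivation `z ∂_z` of formal power series. -/
def eulerDer {R : Type*} [Ring R] (f : PowerSeries R) : PowerSeries R :=
  PowerSeries.mk fun n => n • PowerSeries.coeff n f

theorem eulerDer_mul {R : Type*} [Ring R] (f f' : PowerSeries R) :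
    eulerDer (f * f') = eulerDer f * f' + f * eulerDer f' := by
  ext n
  rw [map_add, eulerDer, PowerSeries.coeff_mk, PowerSeries.coeff_mul, PowerSeries.coeff_mul,
    PowerSeries.coeff_mul, ← Finset.sum_add_distrib, Finset.smul_sum]
  refine Finset.sum_congr rfl fun p hp => ?_
  rw [eulerDer, eulerDer, PowerSeries.coeff_mk, PowerSeries.coeff_mk,
    ← Finset.HasAntidiagonal.mem_antidiagonal.1 hp, add_smul, smul_mul_assoc, mul_smul_comm]

open PowerSeries in
/-- The intertwining relation in terms of generating series. -/
theorem intertwines_extendZero_iff (A : ℕ → Module.End ℂ V) :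
    Intertwines U Q Q' S S' (extendZero A) ↔
      C U * PowerSeries.mk A - PowerSeries.mk A * C U + X * eulerDer (PowerSeries.mk A) - X * (C Q * PowerSeries.mk A) + X * (PowerSeries.mk A * C Q') -
        X * (X * (C S * PowerSeries.mk A)) + X * (X * (PowerSeries.mk A * C S')) = 0 := by
  -- The power series identity is $X$ times the Laurent relation, so its coefficient $n$ is relation
  -- $j=n-1$.
  have key : ∀ n : ℕ, coeff n (C U * PowerSeries.mk A - PowerSeries.mk A * C U + X * eulerDer (PowerSeries.mk A) -
      X * (C Q * PowerSeries.mk A) + X * (PowerSeries.mk A * C Q') - X * (X * (C S * PowerSeries.mk A)) + X * (X * (PowerSeries.mk A * C S'))) =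
      U * extendZero A ((n : ℤ) - 1 + 1) - extendZero A ((n : ℤ) - 1 + 1) * U +
        (((n : ℤ) - 1 : ℤ) : ℂ) • extendZero A ((n : ℤ) - 1) - Q * extendZero A ((n : ℤ) - 1) +
        extendZero A ((n : ℤ) - 1) * Q' - S * extendZero A ((n : ℤ) - 1 - 1) +
        extendZero A ((n : ℤ) - 1 - 1) * S' := by
    intro n
    rw [sub_add_cancel, extendZero_natCast]
    rcases n with _ | _ | n
    · rw [extendZero_of_neg _ (by simp), extendZero_of_neg _ (by simp)]
      simp
    · rw [show ((0 + 1 : ℕ) : ℤ) - 1 = (0 : ℕ) by simp, extendZero_natCast,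
        extendZero_of_neg _ (by simp)]
      simp [coeff_succ_X_mul, eulerDer]
    · rw [show ((n + 1 + 1 : ℕ) : ℤ) - 1 = (n + 1 : ℕ) by push_cast; ring, extendZero_natCast,
        show ((n + 1 : ℕ) : ℤ) - 1 = (n : ℕ) by push_cast; ring, extendZero_natCast]
      simp [coeff_succ_X_mul, eulerDer, ← Nat.cast_smul_eq_nsmul ℂ]
  constructor
  · intro h
    ext1 n
    rw [key, h, map_zero]
  · intro h j
    rcases lt_or_ge j (-1) with hj | hj
    · rw [extendZero_of_neg _ (show j < 0 by lia), extendZero_of_neg _ (show j + 1 < 0 by lia),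
        extendZero_of_neg _ (show j - 1 < 0 by lia)]
      simp
    · obtain ⟨n, hn⟩ := Int.eq_ofNat_of_zero_le (show 0 ≤ j + 1 by lia)
      obtain rfl : j = (n : ℤ) - 1 := by lia
      rw [← key, h, map_zero]

/-- Multiply the equation of $B$ by $A$ on the right and that of $A$ by $B$ on the left and add: the
middle terms $BUA$, $BQA$, $BSA$ cancel, $X$ is central, and the Euler terms combine by the Leibniz
rule. -/
theorem Intertwines.comp {Q₂ S₂ : Module.End ℂ V} {A B : ℕ → Module.End ℂ V}
    (hB : Intertwines U Q₂ Q S₂ S (extendZero B))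
    (hA : Intertwines U Q Q' S S' (extendZero A)) :
    Intertwines U Q₂ Q' S₂ S' (extendZero fun m =>
      ∑ p ∈ Finset.HasAntidiagonal.antidiagonal m, B p.1 * A p.2) := by
  rw [intertwines_extendZero_iff] at hA hB ⊢
  have hmul : PowerSeries.mk (fun m => ∑ p ∈ Finset.HasAntidiagonal.antidiagonal m, B p.1 * A p.2) =
      PowerSeries.mk B * PowerSeries.mk A := by
    ext1 m
    rw [PowerSeries.coeff_mk, PowerSeries.coeff_mul]
    simp
  have hX : ∀ f : PowerSeries (Module.End ℂ V),
      PowerSeries.mk B * (PowerSeries.X * f) = PowerSeries.X * (PowerSeries.mk B * f) := fun f => by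
    rw [← mul_assoc, (PowerSeries.commute_X (PowerSeries.mk B)).eq, mul_assoc]
  have h1 := congrArg (fun f => f * PowerSeries.mk A) hB
  have h2 := congrArg (fun f => PowerSeries.mk B * f) hA
  simp only [mul_add, mul_sub, hX, mul_zero] at h2
  simp only [add_mul, sub_mul, zero_mul] at h1
  rw [hmul, eulerDer_mul]
  have h3 := congrArg₂ (· + ·) h1 h2
  simp only [add_zero] at h3
  rw [← h3]
  noncomm_ring

theorem intertwines_one : Intertwines U Q Q S S (extendZero fun n => if n = 0 then 1 else 0) := by
  have key : ∀ j : ℤ, extendZero (fun n => if n = 0 then (1 : Module.End ℂ V) else 0) j =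
      if j = 0 then 1 else 0 := fun j => by
    rcases lt_or_ge j 0 with hj | hj
    · rw [extendZero_of_neg _ hj, if_neg hj.ne]
    · obtain ⟨n, rfl⟩ := Int.eq_ofNat_of_zero_le hj
      simp
  intro j
  rw [key, key, key]
  split_ifs <;> simp_all

theorem Intertwines.sub {T T' : ℤ → Module.End ℂ V} (h : Intertwines U Q Q' S S' T)
    (h' : Intertwines U Q Q' S S' T') : Intertwines U Q Q' S S' (T - T') := by
  intro j
  have h1 := congrArg₂ (· - ·) (h j) (h' j)
  simp only [sub_zero] at h1
  rw [← h1]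
  simp only [Pi.sub_apply, smul_sub]
  noncomm_ring

theorem SimpleSymmetric.nondegenerate (hg : SimpleSymmetric g U) :
    LinearMap.BilinForm.Nondegenerate g :=
  ⟨fun a h => hg.g_nondeg a h, fun a h => hg.g_nondeg a fun b => by rw [hg.g_symm, h]⟩

/-- The adjoint of a formal intertwiner, with `z` replaced by `-z`, is a formal intertwiner. -/
theorem Intertwines.adjoint (hg : SimpleSymmetric g U) (hQ : IsSkew g Q) (hQ' : IsSkew g Q')
    (hS : ∀ a b, g (S a) b = g a (S b)) (hS' : ∀ a b, g (S' a) b = g a (S' b))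
    {T T' : ℤ → Module.End ℂ V} (hT : Intertwines U Q Q' S S' T)
    (hadj : ∀ j a b, g (T' j a) b = (-1 : ℂ) ^ j * g a (T j b)) :
    Intertwines U Q' Q S' S T' := by
  intro j
  refine LinearMap.ext fun a => hg.g_nondeg _ fun b => ?_
  have h := congrArg (fun f : Module.End ℂ V => g a (f b)) (hT j)
  simp only [LinearMap.add_apply, LinearMap.sub_apply, Module.End.mul_apply, map_add, map_sub,
    LinearMap.smul_apply, map_smul, smul_eq_mul, LinearMap.zero_apply, map_zero] at h ⊢
  have hz : (-1 : ℂ) ≠ 0 := by norm_num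
  rw [hg.g_U, hadj, hadj, hadj, hadj, hS', hadj, hadj, hQ', hadj, zpow_add_one₀ hz,
    zpow_sub_one₀ hz, hg.g_U, hQ a, hS]
  -- Taking adjoints reverses products, and the substitution $z\mapsto-z$ restores the signs: the
  -- neighbouring coefficients acquire $-(-1)^j$, and the skewness of $Q$ and $Q'$ compensates in
  -- the middle ones.
  linear_combination (-1 : ℂ) ^ j * h

/-- A formal intertwiner with constant term `1` is an isometry. -/
theorem Intertwines.isometry (hg : SimpleSymmetric g U) (hQ : IsSkew g Q) (hQ' : IsSkew g Q')
    (hS : ∀ a b, g (S a) b = g a (S b)) (hS' : ∀ a b, g (S' a) b = g a (S' b))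
    {A : ℕ → Module.End ℂ V} (h0 : A 0 = 1) (hA : Intertwines U Q Q' S S' (extendZero A))
    (m : ℕ) (a b : V) :
    ∑ p ∈ Finset.HasAntidiagonal.antidiagonal m, (-1 : ℂ) ^ p.1 * g (A p.2 a) (A p.1 b) =
      if m = 0 then g a b else 0 := by
  let B : ℕ → Module.End ℂ V := fun q =>
    (-1 : ℂ) ^ q • LinearMap.BilinForm.leftAdjointOfNondegenerate g hg.nondegenerate (A q)
  have hBadj : ∀ q a b, g (B q a) b = (-1 : ℂ) ^ q * g a (A q b) := fun q a b => by
    have := LinearMap.BilinForm.isAdjointPairLeftAdjointOfNondegenerate g hg.nondegenerate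
      (A q) a b
    simp only [B, LinearMap.smul_apply, map_smul, smul_eq_mul]
    rw [this]
  have hB : Intertwines U Q' Q S' S (extendZero B) := by
    refine hA.adjoint hg hQ hQ' hS hS' fun j a b => ?_
    rcases lt_or_ge j 0 with hj | hj
    · rw [extendZero_of_neg _ hj, extendZero_of_neg _ hj]
      simp
    · obtain ⟨n, rfl⟩ := Int.eq_ofNat_of_zero_le hj
      rw [extendZero_natCast, extendZero_natCast, hBadj, zpow_natCast]
  -- The composite $B\circ A$ intertwines $(Q',S')$ with itself and has constant term $1$; its
  -- difference from $1$ vanishes by uniqueness.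
  have hsub := (hB.comp hA).sub intertwines_one
  have hB0 : B 0 = 1 := by
    refine LinearMap.ext fun a => sub_eq_zero.1 (hg.g_nondeg _ fun b => ?_)
    rw [map_sub, LinearMap.sub_apply, hBadj, h0]
    simp
  have hm := hsub.eq_zero hg hQ' hQ' ?_ ?_ m
  · rw [Pi.sub_apply, extendZero_natCast, extendZero_natCast, sub_eq_zero] at hm
    have := congrArg (fun f : Module.End ℂ V => g (f a) b) hm
    simp only [LinearMap.sum_apply, map_sum, Module.End.mul_apply, hBadj] at this
    rw [this]
    split_ifs <;> simp
  · rw [Pi.sub_apply, extendZero_of_neg _ (by simp), extendZero_of_neg _ (by simp), sub_zero]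
  · have h := extendZero_natCast (W := Module.End ℂ V) (n := 0)
    simp only [Nat.cast_zero] at h
    rw [Pi.sub_apply, h, h]
    simp [hB0, h0]

end FormalSeries

end

end TTStar
namespace TTStar

noncomputable section

/-! ### Operations on local sections that depend only on the value at a point. -/

section Tensoriality

set_option linter.unusedSectionVars false

variable {E : Type*} [NormedAddCommGroup E] [NormedSpace ℂ E]
  {M : Type*} [TopologicalSpace M] [ChartedSpace E M]
  {F : Type*} [NormedAddCommGroup F] [NormedSpace ℂ F] [FiniteDimensional ℂ F]
  {K : M → Type*} [TopologicalSpace (TotalSpace F K)]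
  [∀ x, AddCommGroup (K x)] [∀ x, Module ℂ (K x)] [∀ x, TopologicalSpace (K x)]
  [FiberBundle F K] [VectorBundle ℂ F K] [ContMDiffVectorBundle ω F K 𝓘(ℂ, E)]

theorem constExtension_add (e : Trivialization F (π F K)) [e.IsLinear ℂ] (v w : F) :
    constExtension e (v + w) = constExtension e v + constExtension e w :=
  funext fun x => map_add (e.symmₗ ℂ x) v w

theorem constExtension_smul (e : Trivialization F (π F K)) [e.IsLinear ℂ] (c : ℂ) (v : F) :
    constExtension e (c • v) = c • constExtension e v :=
  funext fun x => map_smul (e.symmₗ ℂ x) c v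

theorem constExtension_sum_real (e : Trivialization F (π F K)) [e.IsLinear ℂ]
    {ι : Type*} (s : Finset ι) (c : ι → ℝ) (v : ι → F) (x : M) :
    constExtension e (∑ i ∈ s, c i • v i) x = ∑ i ∈ s, c i • constExtension e (v i) x := by
  simp only [constExtension, map_sum, ← Complex.coe_smul, map_smul]

theorem constExtension_apply_self (e : Trivialization F (π F K)) [e.IsLinear ℂ] {x : M} (hx : x ∈ e.baseSet)
    (v : K x) : constExtension e (e ⟨x, v⟩).2 x = v := by
  simp [constExtension, e.coe_symmₗ hx, e.symm_apply_apply_mk hx]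

theorem SmoothOn.const_smul {s : ∀ y, K y} {u : Set M} (hs : SmoothOn E F s u) (hu : IsOpen u)
    (c : ℂ) : SmoothOn E F (c • s) u := by
  refine smoothOn_of_locally fun x hx => ?_
  let e := trivializationAt F K x
  have hv : IsOpen (u ∩ e.baseSet) := hu.inter e.open_baseSet
  refine ⟨u ∩ e.baseSet, hv, ⟨hx, FiberBundle.mem_baseSet_trivializationAt F K x⟩, ?_⟩
  rw [smoothOn_iff _ hv e inter_subset_right]
  have h := (smoothOn_iff _ hv e inter_subset_right).1 (hs.mono inter_subset_left)
  let L : F →L[ℝ] F := (c • ContinuousLinearMap.id ℂ F).restrictScalars ℝ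
  exact (L.contMDiff.comp_contMDiffOn h).congr fun y hy =>
    (e.linear ℂ hy.2).map_smul c (s y)

variable (E F) in
/-- `Φ` is a tensorial operation at `x` on smooth sections of `K`. -/
structure IsTensorialAt {W : Type*} [AddCommGroup W] [Module ℝ W] (x : M)
    (Φ : (∀ y, K y) → W) : Prop where
  add : ∀ (u : Set M) (s t : ∀ y, K y), IsOpen u → x ∈ u → SmoothOn E F s u → SmoothOn E F t u →
    Φ (s + t) = Φ s + Φ t
  smul : ∀ (u : Set M) (f : M → ℝ) (s : ∀ y, K y), IsOpen u → x ∈ u →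
    ContMDiffOn 𝓘(ℝ, E) 𝓘(ℝ, ℝ) ∞ f u → SmoothOn E F s u → Φ (f • s) = f x • Φ s

namespace IsTensorialAt

variable {W : Type*} [AddCommGroup W] [Module ℝ W] {x : M} {Φ : (∀ y, K y) → W}

theorem map_zero (hΦ : IsTensorialAt E F x Φ) : Φ 0 = 0 := by
  have h := hΦ.smul univ (fun _ => 0) 0 isOpen_univ (mem_univ x) contMDiffOn_const
    (smoothOn_zero _)
  rw [zero_smul] at h
  rwa [smul_zero] at h

theorem map_sum (hΦ : IsTensorialAt E F x Φ) {u : Set M} (hu : IsOpen u) (hx : x ∈ u) {ι : Type*}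
    (I : Finset ι) (s : ι → ∀ y, K y) (hs : ∀ i, SmoothOn E F (s i) u) :
    SmoothOn E F (∑ i ∈ I, s i) u ∧ Φ (∑ i ∈ I, s i) = ∑ i ∈ I, Φ (s i) := by
  classical
  induction I using Finset.induction_on with
  | empty => exact ⟨smoothOn_zero u, hΦ.map_zero⟩
  | insert i I hi ih =>
    rw [Finset.sum_insert hi, Finset.sum_insert hi]
    exact ⟨(hs i).add ih.1, by rw [hΦ.add u _ _ hu hx (hs i) ih.1, ih.2]⟩

theorem map_eq_zero_of_eqOn (hΦ : IsTensorialAt E F x Φ) {u : Set M} (hu : IsOpen u) (hx : x ∈ u)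
    {s : ∀ y, K y} (hs : ∀ y ∈ u, s y = 0) : Φ s = 0 := by
  classical
  have hsm : SmoothOn E F s u := ContMDiffOn.congr (smoothOn_zero u) fun y hy => by
    rw [hs y hy]; rfl
  -- Because $s$ vanishes on $u$ and $f=1$ off $u$, one has $fs=s$ globally, while $f(x)=0$. Only
  -- smoothness on $u$ is asked of $f$, so no bump function is needed.
  let f : M → ℝ := fun y => if y ∈ u then 0 else 1
  have hf : ContMDiffOn 𝓘(ℝ, E) 𝓘(ℝ, ℝ) ∞ f u :=
    (contMDiffOn_const (c := (0 : ℝ))).congr fun y hy => if_pos hy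
  have hfs : f • s = s := by
    funext y
    by_cases hy : y ∈ u
    · simp [f, hs y hy]
    · simp [f, hy]
  have h := hΦ.smul u f s hu hx hf hsm
  rw [hfs] at h
  simpa [f, hx] using h

/-- A tensorial operation only depends on the value of the section at the point. -/
theorem map_eq_zero (hΦ : IsTensorialAt E F x Φ) {u : Set M} (hu : IsOpen u) (hx : x ∈ u)
    {s : ∀ y, K y} (hs : SmoothOn E F s u) (hsx : s x = 0) : Φ s = 0 := by
  let e := trivializationAt F K x
  have hxe : x ∈ e.baseSet := FiberBundle.mem_baseSet_trivializationAt F K x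
  let v := u ∩ e.baseSet
  have hv : IsOpen v := hu.inter e.open_baseSet
  have hxv : x ∈ v := ⟨hx, hxe⟩
  have hsv : SmoothOn E F s v := hs.mono inter_subset_left
  have : FiniteDimensional ℝ F := FiniteDimensional.complexToReal F
  let b := Module.finBasis ℝ F
  let c : Fin (Module.finrank ℝ F) → M → ℝ := fun i y => b.repr (e ⟨y, s y⟩).2 i
  have hc : ∀ i, ContMDiffOn 𝓘(ℝ, E) 𝓘(ℝ, ℝ) ∞ (c i) v := fun i =>
    (LinearMap.toContinuousLinearMap (b.coord i)).contMDiff.comp_contMDiffOn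
      ((smoothOn_iff s hv e inter_subset_right).1 hsv)
  -- The expansion of $s$ in the local frame; it agrees with $s$ only on $v$, which suffices by
  -- locality, and its coefficients vanish at $x$.
  let t : ∀ y, K y := ∑ i, c i • constExtension e (b i)
  have hterm : ∀ i, SmoothOn E F (c i • constExtension e (b i)) v := fun i =>
    SmoothOn.smul (hc i) ((smoothOn_constExtension e (b i)).mono inter_subset_right)
  obtain ⟨ht, htΦ⟩ := hΦ.map_sum hv hxv Finset.univ _ hterm
  have hst : ∀ y ∈ v, s y = t y := fun y hy => by
    rw [← constExtension_apply_self e hy.2 (s y), ← b.sum_repr (e ⟨y, s y⟩).2,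
      constExtension_sum_real]
    simp [t, c]
  have hdiff : Φ (s - t) = 0 :=
    hΦ.map_eq_zero_of_eqOn hv hxv fun y hy => sub_eq_zero.2 (hst y hy)
  have h1 := hΦ.add v (s - t) t hv hxv (hsv.sub ht) ht
  rw [sub_add_cancel, hdiff, zero_add, htΦ] at h1
  rw [h1]
  refine Finset.sum_eq_zero fun i _ => ?_
  rw [hΦ.smul v _ _ hv hxv (hc i) ((smoothOn_constExtension e (b i)).mono inter_subset_right)]
  have : c i x = 0 := by
    have h0 : (e ⟨x, (0 : K x)⟩).2 = 0 := (e.linear ℂ hxe).map_zero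
    simp only [c, hsx, h0, _root_.map_zero]
    rfl
  rw [this, zero_smul]

theorem congr (hΦ : IsTensorialAt E F x Φ) {u : Set M} (hu : IsOpen u) (hx : x ∈ u)
    {s t : ∀ y, K y} (hs : SmoothOn E F s u) (ht : SmoothOn E F t u) (hst : s x = t x) :
    Φ s = Φ t := by
  have h := hΦ.add u (s - t) t hu hx (hs.sub ht) ht
  rwa [sub_add_cancel, hΦ.map_eq_zero hu hx (hs.sub ht) (sub_eq_zero.2 hst), zero_add] at h

end IsTensorialAt

variable (E F) in
/-- `P` is a `ℂ`-linear first order differential operator at `x` on smooth sections of `K` with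
scalar symbol `σ`. -/
structure IsDerivationAt (x : M) (σ : (M → ℝ) → ℂ) (P : (∀ y, K y) → K x) : Prop where
  add : ∀ (u : Set M) (s t : ∀ y, K y), IsOpen u → x ∈ u → SmoothOn E F s u → SmoothOn E F t u →
    P (s + t) = P s + P t
  csmul : ∀ (c : ℂ) (u : Set M) (s : ∀ y, K y), IsOpen u → x ∈ u → SmoothOn E F s u →
    P (c • s) = c • P s
  smul : ∀ (f : M → ℝ) (u : Set M) (s : ∀ y, K y), IsOpen u → x ∈ u →
    ContMDiffOn 𝓘(ℝ, E) 𝓘(ℝ, ℝ) ∞ f u → SmoothOn E F s u → P (f • s) = f x • P s + σ f • s x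

namespace IsDerivationAt

variable {x : M} {σ : (M → ℝ) → ℂ} {P : (∀ y, K y) → K x}

theorem map_sub (hP : IsDerivationAt E F x σ P) {u : Set M} (hu : IsOpen u) (hx : x ∈ u)
    {s t : ∀ y, K y} (hs : SmoothOn E F s u) (ht : SmoothOn E F t u) :
    P (s - t) = P s - P t := by
  have h := hP.add u (s - t) t hu hx (hs.sub ht) ht
  rw [sub_add_cancel] at h
  rw [h, add_sub_cancel_right]

theorem map_zero (hP : IsDerivationAt E F x σ P) : P 0 = 0 := by
  have h := hP.csmul 0 univ 0 isOpen_univ (mem_univ x) (smoothOn_zero _)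
  rwa [zero_smul, zero_smul] at h

end IsDerivationAt

end Tensoriality

/-! ### The $(1,0)$- and $(0,1)$-parts of a connection as derivations. -/

section Connection

set_option linter.unusedSectionVars false

variable {E : Type*} [NormedAddCommGroup E] [NormedSpace ℂ E]
  {M : Type*} [TopologicalSpace M] [ChartedSpace E M] [IsManifold 𝓘(ℂ, E) ω M]
  {F : Type*} [NormedAddCommGroup F] [NormedSpace ℂ F] [FiniteDimensional ℂ F]
  {K : M → Type*} [TopologicalSpace (TotalSpace F K)]
  [∀ x, AddCommGroup (K x)] [∀ x, Module ℂ (K x)] [∀ x, TopologicalSpace (K x)]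
  [∀ x, IsTopologicalAddGroup (K x)] [∀ x, ContinuousSMul ℂ (K x)]
  [FiberBundle F K] [VectorBundle ℂ F K] [ContMDiffVectorBundle ω F K 𝓘(ℂ, E)]

theorem SmoothOn.mdifferentiableAt {s : ∀ y, K y} {u : Set M} (hs : SmoothOn E F s u)
    (hu : IsOpen u) {x : M} (hx : x ∈ u) :
    MDifferentiableAt 𝓘(ℝ, E) (𝓘(ℝ, E).prod 𝓘(ℝ, F)) (fun x => TotalSpace.mk' F x (s x)) x :=
  (ContMDiffOn.contMDiffAt hs (hu.mem_nhds hx)).mdifferentiableAt (by simp)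

namespace Connection

variable (D : Connection E F K) {u : Set M} {x : M} {s t : ∀ y, K y}

theorem toFun_add (hu : IsOpen u) (hx : x ∈ u) (hs : SmoothOn E F s u) (ht : SmoothOn E F t u) :
    D.toFun (s + t) x = D.toFun s x + D.toFun t x :=
  D.isCovariantDerivativeOnUniv.add (hs.mdifferentiableAt hu hx) (ht.mdifferentiableAt hu hx)

theorem toFun_smul (hu : IsOpen u) (hx : x ∈ u) {f : M → ℝ}
    (hf : ContMDiffOn 𝓘(ℝ, E) 𝓘(ℝ, ℝ) ∞ f u) (hs : SmoothOn E F s u)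
    (v : TangentSpace 𝓘(ℝ, E) x) :
    D.toFun (f • s) x v = f x • D.toFun s x v + mvfderiv 𝓘(ℝ, E) f x v • s x := by
  rw [D.isCovariantDerivativeOnUniv.leibniz (hs.mdifferentiableAt hu hx)
    ((hf.contMDiffAt (hu.mem_nhds hx)).mdifferentiableAt (by simp))]
  rfl

theorem toFun_complex_smul (hu : IsOpen u) (hx : x ∈ u) (hs : SmoothOn E F s u) (c : ℂ)
    (v : TangentSpace 𝓘(ℝ, E) x) : D.toFun (c • s) x v = c • D.toFun s x v := by
  have hI : SmoothOn E F (Complex.I • s) u := hs.const_smul hu _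
  -- The connection is a covariant derivative over the reals: $c$ is split into constant real
  -- functions, whose derivatives vanish, and `map_I` treats $i$.
  have hre : ContMDiffOn 𝓘(ℝ, E) 𝓘(ℝ, ℝ) ∞ (fun _ : M => c.re) u := contMDiffOn_const
  have him : ContMDiffOn 𝓘(ℝ, E) 𝓘(ℝ, ℝ) ∞ (fun _ : M => c.im) u := contMDiffOn_const
  have hc : c • s = (fun _ : M => c.re) • s + (fun _ : M => c.im) • (Complex.I • s) := by
    funext y
    change c • s y = c.re • s y + c.im • (Complex.I • s y)
    conv_lhs => rw [← Complex.re_add_im c]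
    rw [add_smul, mul_smul, Complex.coe_smul, Complex.coe_smul]
  rw [hc, D.toFun_add hu hx (SmoothOn.smul hre hs) (SmoothOn.smul him hI),
    add_apply, D.toFun_smul hu hx hre hs, D.toFun_smul hu hx him hI,
    mvfderiv_const, mvfderiv_const, show D.toFun (Complex.I • s) x v = Complex.I • D.toFun s x v
      from D.map_I u s hu hs x hx v]
  conv_rhs => rw [← Complex.re_add_im c]
  rw [add_smul, mul_smul, Complex.coe_smul, Complex.coe_smul]
  simp

/-- The derivative of a real function along a vector of type `(1,0)`. -/
def dSymbol (x : M) (X : TangentSpace 𝓘(ℂ, E) x) (f : M → ℝ) : ℂ :=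
  (1 / 2 : ℂ) * ((mvfderiv 𝓘(ℝ, E) f x (realVector X) : ℝ) -
    Complex.I * (mvfderiv 𝓘(ℝ, E) f x (realVector (Complex.I • X)) : ℝ))

/-- The derivative of a real function along a vector of type `(0,1)`. -/
def dbarSymbol (x : M) (X : TangentSpace 𝓘(ℂ, E) x) (f : M → ℝ) : ℂ :=
  (1 / 2 : ℂ) * ((mvfderiv 𝓘(ℝ, E) f x (realVector X) : ℝ) +
    Complex.I * (mvfderiv 𝓘(ℝ, E) f x (realVector (Complex.I • X)) : ℝ))

theorem isDerivationAt_d (x : M) (X : TangentSpace 𝓘(ℂ, E) x) :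
    IsDerivationAt E F x (dSymbol x X) (fun s => D.d s x X) where
  add u s t hu hx hs ht := by
    simp only [d, D.toFun_add hu hx hs ht, add_apply]
    module
  csmul c u s hu hx hs := by
    simp only [d, D.toFun_complex_smul hu hx hs]
    module
  smul f u s hu hx hf hs := by
    simp only [d, dSymbol, D.toFun_smul hu hx hf hs, ← Complex.coe_smul]
    module

theorem isDerivationAt_dbar (x : M) (X : TangentSpace 𝓘(ℂ, E) x) :
    IsDerivationAt E F x (dbarSymbol x X) (fun s => D.dbar s x X) where
  add u s t hu hx hs ht := by
    simp only [dbar, D.toFun_add hu hx hs ht, add_apply]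
    module
  csmul c u s hu hx hs := by
    simp only [dbar, D.toFun_complex_smul hu hx hs]
    module
  smul f u s hu hx hf hs := by
    simp only [dbar, dbarSymbol, D.toFun_smul hu hx hf hs, ← Complex.coe_smul]
    module

end Connection

end Connection

end

end TTStar
namespace TTStar

noncomputable section

/-! ### The gauge defect of a formal automorphism along $M$. -/

section Gauge

set_option linter.unusedSectionVars false

variable {E : Type*} [NormedAddCommGroup E] [NormedSpace ℂ E]
  {M : Type*} [TopologicalSpace M] [ChartedSpace E M]
  {F : Type*} [NormedAddCommGroup F] [NormedSpace ℂ F] [FiniteDimensional ℂ F]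
  {K : M → Type*} [TopologicalSpace (TotalSpace F K)]
  [∀ x, AddCommGroup (K x)] [∀ x, Module ℂ (K x)] [∀ x, TopologicalSpace (K x)]
  [FiberBundle F K] [VectorBundle ℂ F K] [ContMDiffVectorBundle ω F K 𝓘(ℂ, E)]

/-- The coefficients of `(D + z⁻¹ C + z C') ∘ A - A ∘ (N + z⁻¹ C)`. -/
def gaugeDefect {x : M} (D N : (∀ y, K y) → K x) (C C' : Module.End ℂ (K x))
    (A : ℤ → ∀ y, Module.End ℂ (K y)) (j : ℤ) (a : ∀ y, K y) : K x :=
  D (fun y => A j y (a y)) - A j x (N a) + C (A (j + 1) x (a x)) - A (j + 1) x (C (a x)) +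
    C' (A (j - 1) x (a x))

variable {x : M} {σ : (M → ℝ) → ℂ} {D N : (∀ y, K y) → K x} {C C' : Module.End ℂ (K x)}
  {A : ℤ → ∀ y, Module.End ℂ (K y)}

/-- $D$ and $N$ share the scalar symbol $\sigma$, so the two terms $\sigma(f)A_j s$ from the Leibniz
rule cancel; the remaining terms are pointwise linear. An abstract $\sigma$ covers the types $(1,0)$
and $(0,1)$ together. -/
theorem isTensorialAt_gaugeDefect (hD : IsDerivationAt E F x σ D) (hN : IsDerivationAt E F x σ N)
    (hA : ∀ j, IsSmoothEnd E F (A j)) (j : ℤ) :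
    IsTensorialAt E F x (gaugeDefect D N C C' A j) where
  add u s t hu hx hs ht := by
    have h : (fun y => A j y ((s + t) y)) = (fun y => A j y (s y)) + fun y => A j y (t y) :=
      funext fun y => map_add (A j y) _ _
    rw [gaugeDefect, h, hD.add u _ _ hu hx (hA j u s hu hs) (hA j u t hu ht),
      hN.add u s t hu hx hs ht, Pi.add_apply]
    simp only [gaugeDefect, map_add]
    abel
  smul u f s hu hx hf hs := by
    have h : (fun y => A j y ((f • s) y)) = f • fun y => A j y (s y) :=
      funext fun y => by
        change A j y (f y • s y) = f y • A j y (s y)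
        rw [← Complex.coe_smul, map_smul, Complex.coe_smul]
    have h2 : (f • s) x = (f x : ℂ) • s x := (Complex.coe_smul _ _).symm
    rw [gaugeDefect, h, hD.smul f u _ hu hx hf (hA j u s hu hs), hN.smul f u s hu hx hf hs, h2]
    simp only [gaugeDefect, map_add, map_smul, ← Complex.coe_smul]
    module

theorem gaugeDefect_smul (hD : IsDerivationAt E F x σ D) (hN : IsDerivationAt E F x σ N)
    (hA : ∀ j, IsSmoothEnd E F (A j)) (j : ℤ) (c : ℂ) {u : Set M} (hu : IsOpen u) (hx : x ∈ u)
    {s : ∀ y, K y} (hs : SmoothOn E F s u) :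
    gaugeDefect D N C C' A j (c • s) = c • gaugeDefect D N C C' A j s := by
  have h : (fun y => A j y ((c • s) y)) = c • fun y => A j y (s y) :=
    funext fun y => map_smul (A j y) _ _
  rw [gaugeDefect, h, hD.csmul c u _ hu hx (hA j u s hu hs), hN.csmul c u s hu hx hs, Pi.smul_apply]
  simp only [gaugeDefect, map_smul]
  module

theorem exists_gaugeDefect_eq (hD : IsDerivationAt E F x σ D) (hN : IsDerivationAt E F x σ N)
    (hA : ∀ j, IsSmoothEnd E F (A j)) :
    ∃ T : ℤ → Module.End ℂ (K x), ∀ (j : ℤ) (u : Set M) (s : ∀ y, K y), IsOpen u → x ∈ u →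
      SmoothOn E F s u → gaugeDefect D N C C' A j s = T j (s x) := by
  let e := trivializationAt F K x
  have hx : x ∈ e.baseSet := FiberBundle.mem_baseSet_trivializationAt F K x
  have hsm := smoothOn_constExtension (E := E) e
  have hΦ := isTensorialAt_gaugeDefect (C := C) (C' := C') hD hN hA
  let T : ℤ → Module.End ℂ (K x) := fun j =>
    { toFun := fun v => gaugeDefect D N C C' A j (constExtension e (e ⟨x, v⟩).2)
      map_add' := fun v w => by
        rw [(e.linear ℂ hx).map_add, constExtension_add,
          (hΦ j).add e.baseSet _ _ e.open_baseSet hx (hsm _) (hsm _)]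
      map_smul' := fun c v => by
        rw [(e.linear ℂ hx).map_smul, constExtension_smul,
          gaugeDefect_smul hD hN hA j c e.open_baseSet hx (hsm _)]
        rfl }
  refine ⟨T, fun j u s hu hxu hs => ?_⟩
  exact (hΦ j).congr (hu.inter e.open_baseSet) ⟨hxu, hx⟩ (hs.mono inter_subset_left)
    ((hsm _).mono inter_subset_right) (constExtension_apply_self e hx (s x)).symm

variable {U Q V S : ∀ y, Module.End ℂ (K y)}

/-- If `D + z⁻¹ C + z C'` and `N + z⁻¹ C` commute with the covariant derivatives along `z ∂_z`,
their difference under a formal intertwiner `A` is again a formal intertwiner. -/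
theorem intertwines_gaugeDefect (hD : IsDerivationAt E F x σ D)
    (hA : ∀ j, IsSmoothEnd E F (A j)) (hU : IsSmoothEnd E F U) (hQ : IsSmoothEnd E F Q)
    (hV : IsSmoothEnd E F V) (hS : IsSmoothEnd E F S)
    (hint : ∀ y, Intertwines (U y) (Q y) (V y) (S y) 0 (fun j => A j y))
    (hDU : ∀ (u : Set M) (s : ∀ y, K y), IsOpen u → x ∈ u → SmoothOn E F s u →
      D (fun y => U y (s y)) = U x (D s) + C (Q x (s x)) - Q x (C (s x)) - C (s x))
    (hDQ : ∀ (u : Set M) (s : ∀ y, K y), IsOpen u → x ∈ u → SmoothOn E F s u →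
      D (fun y => Q y (s y)) = Q x (D s) - U x (C' (s x)) + C' (U x (s x)) +
        S x (C (s x)) - C (S x (s x)))
    (hDS : ∀ (u : Set M) (s : ∀ y, K y), IsOpen u → x ∈ u → SmoothOn E F s u →
      D (fun y => S y (s y)) = S x (D s) - C' (s x) + Q x (C' (s x)) - C' (Q x (s x)))
    (hNU : ∀ (u : Set M) (s : ∀ y, K y), IsOpen u → x ∈ u → SmoothOn E F s u →
      N (fun y => U y (s y)) = U x (N s) + C (V x (s x)) - V x (C (s x)) - C (s x))
    (hNV : ∀ (u : Set M) (s : ∀ y, K y), IsOpen u → x ∈ u → SmoothOn E F s u →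
      N (fun y => V y (s y)) = V x (N s))
    (hUC : ∀ v, U x (C v) = C (U x v)) (hSC' : ∀ v, S x (C' v) = C' (S x v))
    {T : ℤ → Module.End ℂ (K x)}
    (hT : ∀ (j : ℤ) (u : Set M) (s : ∀ y, K y), IsOpen u → x ∈ u →
      SmoothOn E F s u → gaugeDefect D N C C' A j s = T j (s x)) :
    Intertwines (U x) (Q x) (V x) (S x) 0 T := by
  intro j
  ext v
  obtain ⟨u, a, hu, hx, ha, rfl⟩ := exists_holoOn_eq E F x v
  replace ha : SmoothOn E F a u := smoothOn_of_holoOn hu ha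
  have hE : ∀ (j : ℤ) (y : M) (w : K y), U y (A (j + 1) y w) - A (j + 1) y (U y w) +
      (j : ℂ) • A j y w - Q y (A j y w) + A j y (V y w) - S y (A (j - 1) y w) = 0 :=
    fun j y w => by
      have := congrArg (fun B : Module.End ℂ (K y) => B w) (hint y j)
      simpa using this
  have hUa := hU u a hu ha
  have hVa := hV u a hu ha
  have hAa := fun j => hA j u a hu ha
  -- The intertwining relation of order $j$, differentiated along $M$.
  have hderiv : D (fun y => U y (A (j + 1) y (a y))) - D (fun y => A (j + 1) y (U y (a y))) +
      (j : ℂ) • D (fun y => A j y (a y)) - D (fun y => Q y (A j y (a y))) +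
      D (fun y => A j y (V y (a y))) - D (fun y => S y (A (j - 1) y (a y))) = 0 := by
    have h1 := hU u _ hu (hAa (j + 1))
    have h2 := hA (j + 1) u _ hu hUa
    have h3 := (hAa j).const_smul hu (j : ℂ)
    have h4 := hQ u _ hu (hAa j)
    have h5 := hA j u _ hu hVa
    have h6 := hS u _ hu (hAa (j - 1))
    rw [← hD.csmul (j : ℂ) u _ hu hx (hAa j), ← hD.map_sub hu hx h1 h2,
      ← hD.add u _ _ hu hx (h1.sub h2) h3, ← hD.map_sub hu hx ((h1.sub h2).add h3) h4,
      ← hD.add u _ _ hu hx (((h1.sub h2).add h3).sub h4) h5,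
      ← hD.map_sub hu hx ((((h1.sub h2).add h3).sub h4).add h5) h6, ← hD.map_zero]
    exact congrArg D (funext fun y => hE j y (a y))
  rw [hDU u _ hu hx (hAa (j + 1)), hDQ u _ hu hx (hAa j), hDS u _ hu hx (hAa (j - 1))] at hderiv
  -- The undifferentiated relation enters four more times, for the other terms of the defect: at
  -- order $j$ on $Na$, at order $j+1$ on both sides of $C$, and at order $j-1$ under $C'$.
  have e1 := hE j x (N a)
  have e2 := congrArg C (hE (j + 1) x (a x))
  have e3 := hE (j + 1) x (C (a x))
  have e4 := congrArg C' (hE (j - 1) x (a x))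
  simp only [LinearMap.add_apply, LinearMap.sub_apply, Module.End.mul_apply, LinearMap.smul_apply,
    LinearMap.zero_apply, add_zero, ← hT _ u a hu hx ha,
    ← hT _ u _ hu hx hUa, ← hT _ u _ hu hx hVa, mul_zero]
  simp only [gaugeDefect, hNU u a hu hx ha, hNV u a hu hx ha, map_add, map_sub, map_smul,
    add_sub_cancel_right, sub_add_cancel, Int.cast_add, Int.cast_sub, Int.cast_one, map_zero,
    hUC, hSC'] at hderiv e1 e2 e3 e4 ⊢
  linear_combination (norm := module) hderiv - e1 + e2 - e3 + e4

end Gauge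

end

end TTStar
namespace TTStar

noncomputable section

/-! ### Smooth dependence of solutions of linear systems. -/

section SmoothMatrices

variable (E : Type*) [NormedAddCommGroup E] [NormedSpace ℂ E]
  {M : Type*} [TopologicalSpace M] [ChartedSpace E M]

/-- The algebra of complex functions which are smooth at `x`. -/
def smoothFunctionsAt (x : M) : Subalgebra ℂ (M → ℂ) where
  carrier := {f | ContMDiffAt 𝓘(ℝ, E) 𝓘(ℝ, ℂ) ∞ f x}
  mul_mem' {f f'} hf hf' := by
    have hm : ContDiff ℝ ∞ fun p : ℂ × ℂ => p.1 * p.2 := contDiff_fst.mul contDiff_snd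
    exact hm.contMDiff.contMDiffAt.comp x (hf.prodMk_space hf')
  add_mem' hf hf' := ContMDiffAt.add hf hf'
  algebraMap_mem' c := contMDiffAt_const

variable {E}

theorem mem_smoothFunctionsAt {x : M} {f : M → ℂ} :
    f ∈ smoothFunctionsAt E x ↔ ContMDiffAt 𝓘(ℝ, E) 𝓘(ℝ, ℂ) ∞ f x := Iff.rfl

theorem inv_mem_smoothFunctionsAt {x : M} {f : M → ℂ} (hf : f ∈ smoothFunctionsAt E x)
    (h : f x ≠ 0) : f⁻¹ ∈ smoothFunctionsAt E x := by
  have hi : ContDiffAt ℝ ∞ (fun z : ℂ => z⁻¹) (f x) := contDiffAt_inv ℝ h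
  exact hi.contMDiffAt.comp x hf

theorem smoothFunctionsAt_congr {x : M} {f f' : M → ℂ} (hf : f ∈ smoothFunctionsAt E x)
    (h : f' =ᶠ[nhds x] f) : f' ∈ smoothFunctionsAt E x :=
  ContMDiffAt.congr_of_eventuallyEq hf h

variable (E) in
/-- The matrix valued function `A` is smooth at `x`. -/
def SmoothMatrixAt {α β : Type*} (x : M) (A : M → Matrix α β ℂ) : Prop :=
  ∀ i k, (fun y => A y i k) ∈ smoothFunctionsAt E x

namespace SmoothMatrixAt

variable {α β γ : Type*} {x : M}

theorem const (A : Matrix α β ℂ) : SmoothMatrixAt E x fun _ => A :=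
  fun i k => (smoothFunctionsAt E x).algebraMap_mem (A i k)

theorem add {A B : M → Matrix α β ℂ} (hA : SmoothMatrixAt E x A) (hB : SmoothMatrixAt E x B) :
    SmoothMatrixAt E x fun y => A y + B y :=
  fun i k => add_mem (hA i k) (hB i k)

theorem sub {A B : M → Matrix α β ℂ} (hA : SmoothMatrixAt E x A) (hB : SmoothMatrixAt E x B) :
    SmoothMatrixAt E x fun y => A y - B y :=
  fun i k => sub_mem (hA i k) (hB i k)

theorem mul [Fintype β] {A : M → Matrix α β ℂ} {B : M → Matrix β γ ℂ}
    (hA : SmoothMatrixAt E x A) (hB : SmoothMatrixAt E x B) :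
    SmoothMatrixAt E x fun y => A y * B y := fun i k => by
  have h : (fun y => (A y * B y) i k) = ∑ j, (fun y => A y i j) * fun y => B y j k := by
    funext y
    simp [Matrix.mul_apply]
  rw [h]
  exact sum_mem fun j _ => mul_mem (hA i j) (hB j k)

theorem pow [Fintype α] [DecidableEq α] {A : M → Matrix α α ℂ} (hA : SmoothMatrixAt E x A)
    (n : ℕ) : SmoothMatrixAt E x fun y => A y ^ n := by
  induction n with
  | zero => simpa only [pow_zero] using const 1
  | succ n ih => simpa only [pow_succ] using ih.mul hA

theorem trace [Fintype α] {A : M → Matrix α α ℂ} (hA : SmoothMatrixAt E x A) :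
    (fun y => (A y).trace) ∈ smoothFunctionsAt E x := by
  have h : (fun y => (A y).trace) = ∑ i, fun y => A y i i := by
    funext y
    simp [Matrix.trace]
  rw [h]
  exact sum_mem fun i _ => hA i i

theorem det [Fintype α] [DecidableEq α] {A : M → Matrix α α ℂ} (hA : SmoothMatrixAt E x A) :
    (fun y => (A y).det) ∈ smoothFunctionsAt E x := by
  have h : (fun y => (A y).det) =
      ∑ τ : Equiv.Perm α, ((Equiv.Perm.sign τ : ℤ) : ℂ) • ∏ i, fun y => A y (τ i) i := by
    funext y
    simp [Matrix.det_apply']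
  rw [h]
  exact sum_mem fun τ _ => Subalgebra.smul_mem _ (prod_mem fun i _ => hA _ _) _

theorem adjugate [Fintype α] [DecidableEq α] {A : M → Matrix α α ℂ}
    (hA : SmoothMatrixAt E x A) : SmoothMatrixAt E x fun y => (A y).adjugate := by
  intro i k
  simp only [Matrix.adjugate_apply]
  refine det fun p q => ?_
  by_cases hp : p = k
  · simp only [hp, Matrix.updateRow_self]
    exact (smoothFunctionsAt E x).algebraMap_mem _
  · simp only [Matrix.updateRow_ne hp]
    exact hA p q

end SmoothMatrixAt

/-- The solution of a smooth system of linear equations is smooth where the system is injective. -/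
theorem smooth_of_mulVec_eq {α β : Type*} [Fintype α] [DecidableEq α] [Fintype β] [DecidableEq β]
    {x : M} {L : M → Matrix β α ℂ} (hL : SmoothMatrixAt E x L)
    (hinj : ∀ v, (L x).mulVec v = 0 → v = 0)
    {r : M → β → ℂ} (hr : ∀ k, (fun y => r y k) ∈ smoothFunctionsAt E x) {B : M → α → ℂ}
    (hB : ∀ᶠ y in nhds x, (L y).mulVec (B y) = r y) (i : α) :
    (fun y => B y i) ∈ smoothFunctionsAt E x := by
  -- A left inverse $\Lambda$ of $L(x)$ turns the possibly overdetermined system into the square one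
  -- $\Lambda L\,B=\Lambda r$, invertible near $x$ because its determinant is $1$ at $x$. Cramer's
  -- rule then expresses $B$ by smooth functions.
  obtain ⟨f, hf⟩ := LinearMap.exists_leftInverse_of_injective (Matrix.toLin' (L x))
    (LinearMap.ker_eq_bot'.2 hinj)
  let Λ : Matrix α β ℂ := LinearMap.toMatrix' f
  have hΛ : Λ * L x = 1 := by
    have := congrArg LinearMap.toMatrix' hf
    rwa [LinearMap.toMatrix'_comp, LinearMap.toMatrix'_toLin', LinearMap.toMatrix'_id] at this
  let m : M → Matrix α α ℂ := fun y => Λ * L y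
  have hm : SmoothMatrixAt E x m := (SmoothMatrixAt.const Λ).mul hL
  have hdet : (fun y => (m y).det) ∈ smoothFunctionsAt E x := hm.det
  have hdetx : (m x).det ≠ 0 := by simp [m, hΛ]
  have hΛr : SmoothMatrixAt E x fun y => Λ * Matrix.of (fun k (_ : Unit) => r y k) :=
    (SmoothMatrixAt.const Λ).mul fun k _ => hr k
  have hsol : (fun y => ((m y).adjugate * (Λ * Matrix.of (fun k (_ : Unit) => r y k))) i ()) ∈
      smoothFunctionsAt E x := hm.adjugate.mul hΛr i ()
  refine smoothFunctionsAt_congr (mul_mem (inv_mem_smoothFunctionsAt hdet hdetx) hsol) ?_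
  have hne : ∀ᶠ y in nhds x, (m y).det ≠ 0 :=
    (mem_smoothFunctionsAt.1 hdet).continuousAt.eventually_ne hdetx
  filter_upwards [hB, hne] with y hy hny
  have h1 : Matrix.of (fun k (_ : Unit) => r y k) = L y * Matrix.of (fun k (_ : Unit) => B y k) := by
    ext k j
    rw [← hy]
    rfl
  change B y i = ((m y).det)⁻¹ * (((m y).adjugate *
    (Λ * Matrix.of (fun k (_ : Unit) => r y k)) : Matrix α Unit ℂ) i ())
  rw [h1, ← Matrix.mul_assoc Λ, ← Matrix.mul_assoc, Matrix.adjugate_mul, Matrix.smul_mul,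
    Matrix.one_mul, Matrix.smul_apply, smul_eq_mul, inv_mul_cancel_left₀ hny]
  rfl

end SmoothMatrices

/-! ### Smooth endomorphisms and the smoothness of the recursion. -/

section SmoothEnd

set_option linter.unusedSectionVars false

open Module

variable {E : Type*} [NormedAddCommGroup E] [NormedSpace ℂ E]
  {M : Type*} [TopologicalSpace M] [ChartedSpace E M]
  {F : Type*} [NormedAddCommGroup F] [NormedSpace ℂ F] [FiniteDimensional ℂ F]
  {K : M → Type*} [TopologicalSpace (TotalSpace F K)]
  [∀ x, AddCommGroup (K x)] [∀ x, Module ℂ (K x)] [∀ x, TopologicalSpace (K x)]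
  [FiberBundle F K] [VectorBundle ℂ F K]

variable (F) in
/-- The basis of the fibre `K y` given by the trivialization of `K` at `x`. -/
def frameBasis (x : M) {y : M} (hy : y ∈ (trivializationAt F K x).baseSet) :
    Basis (Fin (finrank ℂ F)) ℂ (K y) :=
  (finBasis ℂ F).map ((trivializationAt F K x).linearEquivAt ℂ y hy).symm

theorem frameBasis_apply (x : M) {y : M} (hy : y ∈ (trivializationAt F K x).baseSet)
    (i : Fin (finrank ℂ F)) :
    frameBasis F x hy i = constExtension (trivializationAt F K x) (finBasis ℂ F i) y := by
  simp [frameBasis, constExtension, Trivialization.coe_symmₗ _ hy]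

theorem frameBasis_repr (x : M) {y : M} (hy : y ∈ (trivializationAt F K x).baseSet) (v : K y)
    (i : Fin (finrank ℂ F)) :
    (frameBasis F x hy).repr v i = (finBasis ℂ F).repr (trivializationAt F K x ⟨y, v⟩).2 i := by
  simp [frameBasis]

variable (F) in
theorem finrank_fiber (x : M) : finrank ℂ (K x) = finrank ℂ F := by
  rw [finrank_eq_card_basis (frameBasis F x (FiberBundle.mem_baseSet_trivializationAt F K x)),
    Fintype.card_fin]

variable (F) in
/-- The matrix of an endomorphism of `K` in the trivialization at `x`. -/
def frameMatrix (x : M) (A : ∀ y, Module.End ℂ (K y)) (y : M) :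
    Matrix (Fin (finrank ℂ F)) (Fin (finrank ℂ F)) ℂ := fun i k =>
  (finBasis ℂ F).repr (trivializationAt F K x
    ⟨y, A y (constExtension (trivializationAt F K x) (finBasis ℂ F k) y)⟩).2 i

theorem frameMatrix_eq (x : M) (A : ∀ y, Module.End ℂ (K y)) {y : M}
    (hy : y ∈ (trivializationAt F K x).baseSet) :
    frameMatrix F x A y = LinearMap.toMatrixAlgEquiv (frameBasis F x hy) (A y) := by
  ext i k
  rw [LinearMap.toMatrixAlgEquiv_apply, frameBasis_repr, frameBasis_apply]
  rfl

variable [ContMDiffVectorBundle ω F K 𝓘(ℂ, E)]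

theorem smoothMatrixAt_frameMatrix {x : M} {A : ∀ y, Module.End ℂ (K y)}
    (hA : ∀ v : F, SmoothOn E F (fun y => A y (constExtension (trivializationAt F K x) v y))
      (trivializationAt F K x).baseSet) :
    SmoothMatrixAt E x (frameMatrix F x A) := by
  intro i k
  let e := trivializationAt F K x
  have hx : x ∈ e.baseSet := FiberBundle.mem_baseSet_trivializationAt F K x
  have h := (smoothOn_iff _ e.open_baseSet e subset_rfl).1 (hA (finBasis ℂ F k))
  let L : F →L[ℝ] ℂ :=
    (LinearMap.toContinuousLinearMap ((finBasis ℂ F).coord i)).restrictScalars ℝ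
  exact (L.contMDiff.comp_contMDiffOn h).contMDiffAt (e.open_baseSet.mem_nhds hx)

theorem isSmoothEnd_of_smoothMatrixAt {A : ∀ y, Module.End ℂ (K y)}
    (hA : ∀ x, SmoothMatrixAt E x (frameMatrix F x A)) : IsSmoothEnd E F A := by
  intro u s hu hs x hxu
  let e := trivializationAt F K x
  have hx : x ∈ e.baseSet := FiberBundle.mem_baseSet_trivializationAt F K x
  refine ContMDiffAt.contMDiffWithinAt ?_
  rw [e.contMDiffAt_section_iff hx]
  have hs' := (e.contMDiffAt_section_iff hx).1 (ContMDiffOn.contMDiffAt hs (hu.mem_nhds hxu))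
  let b := finBasis ℂ F
  have hcoord : ∀ k, (fun y => b.repr (e ⟨y, s y⟩).2 k) ∈ smoothFunctionsAt E x := fun k => by
    let L : F →L[ℝ] ℂ :=
      (LinearMap.toContinuousLinearMap (b.coord k)).restrictScalars ℝ
    exact L.contMDiff.contMDiffAt.comp x hs'
  have hentry : ∀ i, ContMDiffAt 𝓘(ℝ, E) 𝓘(ℝ, ℂ) ∞
      (∑ k, (fun y => frameMatrix F x A y i k) * fun y => b.repr (e ⟨y, s y⟩).2 k) x := fun i =>
    sum_mem (S := smoothFunctionsAt E x) fun k _ => mul_mem (hA x i k) (hcoord k)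
  have hsum : ContMDiffAt 𝓘(ℝ, E) 𝓘(ℝ, F) ∞ (fun y => ∑ i,
      (∑ k, (fun y => frameMatrix F x A y i k) * fun y => b.repr (e ⟨y, s y⟩).2 k) y • b i) x := by
    refine contMDiffAt_finsetSum fun i _ => ?_
    let L : ℂ →L[ℝ] F := (ContinuousLinearMap.toSpanSingleton ℂ (b i)).restrictScalars ℝ
    exact L.contMDiff.contMDiffAt.comp x (hentry i)
  refine hsum.congr_of_eventuallyEq ?_
  filter_upwards [e.open_baseSet.mem_nhds hx] with y hy
  rw [← b.sum_repr (e ⟨y, A y (s y)⟩).2]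
  refine Finset.sum_congr rfl fun i _ => ?_
  congr 1
  have h := LinearMap.toMatrix_mulVec_repr (frameBasis F x hy) (frameBasis F x hy) (A y) (s y)
  have h2 := congrFun h i
  rw [frameBasis_repr] at h2
  rw [← h2, Finset.sum_apply, Matrix.mulVec, dotProduct]
  refine Finset.sum_congr rfl fun k _ => ?_
  rw [Pi.mul_apply, frameMatrix_eq x A hy, frameBasis_repr]
  rfl

theorem IsSmoothEnd.smoothMatrixAt {A : ∀ y, Module.End ℂ (K y)} (hA : IsSmoothEnd E F A) (x : M) :
    SmoothMatrixAt E x (frameMatrix F x A) :=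
  smoothMatrixAt_frameMatrix fun v => hA _ _ (trivializationAt F K x).open_baseSet
    (smoothOn_constExtension _ v)

/-- `IsHoloEnd` tests holomorphic sections only, but the local frames are holomorphic, so the matrix
entries are smooth and every smooth section can be treated. -/
theorem IsHoloEnd.isSmoothEnd {A : ∀ y, Module.End ℂ (K y)} (hA : IsHoloEnd E F A) :
    IsSmoothEnd E F A :=
  isSmoothEnd_of_smoothMatrixAt fun x => smoothMatrixAt_frameMatrix fun v =>
    smoothOn_of_holoOn (trivializationAt F K x).open_baseSet
      (hA _ _ (trivializationAt F K x).open_baseSet (holoOn_constExtension _ v))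

/-- The normalized solution of a smooth commutator equation is smooth. -/
theorem isSmoothEnd_of_commutator_eq {g : ∀ y, K y →ₗ[ℂ] K y →ₗ[ℂ] ℂ}
    {U Q V R S B : ∀ y, Module.End ℂ (K y)}
    (hg : ∀ y, SimpleSymmetric (g y) (U y)) (hQ : ∀ y, IsSkew (g y) (Q y))
    (hV : ∀ y, IsSkew (g y) (V y)) {c : ℂ} (hc : c ≠ 0)
    (hU' : IsSmoothEnd E F U) (hQ' : IsSmoothEnd E F Q) (hV' : IsSmoothEnd E F V)
    (hR' : IsSmoothEnd E F R) (hS' : IsSmoothEnd E F S)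
    (hR : ∀ y, U y * B y - B y * U y = R y)
    (hB : ∀ y, TraceOrth (U y) (c • B y - Q y * B y + B y * V y - S y)) :
    IsSmoothEnd E F B := by
  refine isSmoothEnd_of_smoothMatrixAt fun x => ?_
  let n := finrank ℂ F
  let e := trivializationAt F K x
  have hx : x ∈ e.baseSet := FiberBundle.mem_baseSet_trivializationAt F K x
  let mat := fun A : ∀ y, Module.End ℂ (K y) => frameMatrix F x A
  have mU : SmoothMatrixAt E x (mat U) := hU'.smoothMatrixAt x
  have mQ : SmoothMatrixAt E x (mat Q) := hQ'.smoothMatrixAt x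
  have mV : SmoothMatrixAt E x (mat V) := hV'.smoothMatrixAt x
  have mR : SmoothMatrixAt E x (mat R) := hR'.smoothMatrixAt x
  have mS : SmoothMatrixAt E x (mat S) := hS'.smoothMatrixAt x
  -- the linear system, as a family of linear maps on matrices
  let sys : M → Matrix (Fin n) (Fin n) ℂ →ₗ[ℂ] ((Fin n × Fin n) ⊕ Fin n → ℂ) := fun y =>
    { toFun := fun X => Sum.elim (fun p => (mat U y * X - X * mat U y) p.1 p.2)
        (fun k => (mat U y ^ (k : ℕ) * (c • X - mat Q y * X + X * mat V y)).trace)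
      map_add' := fun X Y => by
        ext (p | k)
        · simp [mul_add, add_mul]
          ring
        · simp [mul_add, add_mul, mul_sub]
          ring
      map_smul' := fun a X => by
        ext (p | k)
        · simp [mul_sub]
        · simp [mul_add, mul_sub]
          ring }
  let rhs : M → ((Fin n × Fin n) ⊕ Fin n → ℂ) := fun y =>
    Sum.elim (fun p => mat R y p.1 p.2) (fun k => (mat U y ^ (k : ℕ) * mat S y).trace)
  let L : M → Matrix ((Fin n × Fin n) ⊕ Fin n) (Fin n × Fin n) ℂ := fun y =>
    LinearMap.toMatrix (Matrix.stdBasis ℂ (Fin n) (Fin n)) (Pi.basisFun ℂ _) (sys y)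
  -- Here $L(y)$ is the matrix of the system for $n^2$ unknown entries and $n^2+n$ equations: the
  -- commutator and the $n$ trace conditions. No eigenbasis occurs, so nothing has to be chosen
  -- smoothly.
  have hLX : ∀ y X, (L y).mulVec (fun p => X p.1 p.2) = sys y X := fun y X =>
    LinearMap.toMatrix_mulVec_repr (Matrix.stdBasis ℂ (Fin n) (Fin n)) (Pi.basisFun ℂ _) (sys y) X
  have hL : SmoothMatrixAt E x L := by
    intro k p
    have hL' : (fun y => L y k p) = fun y => sys y (Matrix.stdBasis ℂ (Fin n) (Fin n) p) k := by
      funext y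
      simp [L, LinearMap.toMatrix_apply]
    rw [hL']
    have hX := SmoothMatrixAt.const (E := E) (x := x) (Matrix.stdBasis ℂ (Fin n) (Fin n) p)
    have hcX := SmoothMatrixAt.const (E := E) (x := x) (c • Matrix.stdBasis ℂ (Fin n) (Fin n) p)
    rcases k with q | k
    · exact ((mU.mul hX).sub (hX.mul mU)) q.1 q.2
    · exact ((mU.pow k).mul ((hcX.sub (mQ.mul hX)).add (hX.mul mV))).trace
  have hrhs : ∀ k, (fun y => rhs y k) ∈ smoothFunctionsAt E x := by
    rintro (q | k)
    · exact mR q.1 q.2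
    · exact ((mU.pow k).mul mS).trace
  have htrace : ∀ {y : M} (hy : y ∈ e.baseSet) (T : Module.End ℂ (K y)),
      LinearMap.trace ℂ (K y) T = (LinearMap.toMatrixAlgEquiv (frameBasis F x hy) T).trace :=
    fun hy T => LinearMap.trace_eq_matrix_trace ℂ (frameBasis F x hy) T
  have hsys : ∀ᶠ y in nhds x, (L y).mulVec (fun p => mat B y p.1 p.2) = rhs y := by
    filter_upwards [e.open_baseSet.mem_nhds hx] with y hy
    rw [hLX]
    ext (p | k)
    · change (mat U y * mat B y - mat B y * mat U y) p.1 p.2 = mat R y p.1 p.2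
      simp only [mat, frameMatrix_eq x _ hy, ← hR, map_sub, map_mul]
    · change (mat U y ^ (k : ℕ) * (c • mat B y - mat Q y * mat B y + mat B y * mat V y)).trace =
        (mat U y ^ (k : ℕ) * mat S y).trace
      have h := hB y (Fin.cast (finrank_fiber F y).symm k)
      rw [mul_sub, map_sub, sub_eq_zero, htrace hy, htrace hy] at h
      simpa only [mat, frameMatrix_eq x _ hy, map_sub, map_mul, map_add, map_pow, map_smul,
        Fin.val_cast] using h
  -- A solution of the homogeneous system commutes with $U$ and satisfies the trace conditions with
  -- $S=0$, so it vanishes by the pointwise uniqueness.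
  have hinj : ∀ v, (L x).mulVec v = 0 → v = 0 := by
    intro v hv
    let X : Matrix (Fin n) (Fin n) ℂ := fun i k => v (i, k)
    have hX := hLX x X
    change (L x).mulVec v = _ at hX
    rw [hv] at hX
    let φ := LinearMap.toMatrixAlgEquiv (frameBasis F x hx)
    let T : Module.End ℂ (K x) := φ.symm X
    have hφT : φ T = X := φ.apply_symm_apply X
    have : FiniteDimensional ℂ (K x) := (frameBasis F x hx).finiteDimensional_of_finite
    have hT : T = 0 := by
      refine eq_zero_of_commute_of_traceOrth_smul (hg x) (hQ x) (hV x) hc ?_ fun k => ?_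
      · apply φ.injective
        ext i k
        have h := congrFun hX (Sum.inl (i, k))
        change 0 = (mat U x * X - X * mat U x) i k at h
        rw [map_sub, map_mul, map_mul, map_zero, hφT, Matrix.zero_apply, h]
        simp only [mat, frameMatrix_eq x _ hx, φ]
      · have h := congrFun hX (Sum.inr (Fin.cast (finrank_fiber F x) k))
        change 0 = (mat U x ^ (k : ℕ) * (c • X - mat Q x * X + X * mat V x)).trace at h
        rw [htrace hx]
        change (φ _).trace = 0
        rw [map_mul, map_add, map_sub, map_mul, map_mul, map_pow, map_smul, hφT, h]
        simp only [mat, frameMatrix_eq x _ hx, φ]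
    funext p
    have h0 : X p.1 p.2 = 0 := by
      rw [← hφT, hT, map_zero, Matrix.zero_apply]
    exact h0
  exact fun i k => smooth_of_mulVec_eq hL hinj hrhs hsys (i, k)

end SmoothEnd

end

end TTStar
namespace TTStar

noncomputable section

/-! ### Coefficients of Laurent series under a formal automorphism and under the pairing. -/

section Series

set_option linter.unusedSectionVars false

variable {E : Type*} [NormedAddCommGroup E] [NormedSpace ℂ E]
  {M : Type*} [TopologicalSpace M] [ChartedSpace E M]
  {F : Type*} [NormedAddCommGroup F] [NormedSpace ℂ F]
  {K : M → Type*} [TopologicalSpace (TotalSpace F K)]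
  [∀ x, AddCommGroup (K x)] [∀ x, Module ℂ (K x)] [∀ x, TopologicalSpace (K x)]
  [FiberBundle F K]

theorem constSeries_zero {W : Type*} [Zero W] (a : W) : constSeries a 0 = a := if_pos rfl

theorem constSeries_of_ne {W : Type*} [Zero W] (a : W) {j : ℤ} (hj : j ≠ 0) :
    constSeries a j = 0 := if_neg hj

theorem constSeries_apply (a : ∀ x, K x) (j : ℤ) (x : M) :
    constSeries a j x = constSeries (a x) j := by
  unfold constSeries
  split_ifs <;> rfl

namespace FormalAutomorphism

variable (Ψ : FormalAutomorphism E F K)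

/-- The action on a series `z⁻¹ c₋₁ + c₀`. -/
theorem act_eq (x : M) {c : ℤ → K x} (hc : ∀ j, j ≠ 0 → j ≠ -1 → c j = 0) (j : ℤ) :
    Ψ.act x c j = extendZero (fun n => Ψ.A n x) j (c 0) +
      extendZero (fun n => Ψ.A n x) (j + 1) (c (-1)) := by
  unfold act
  rcases lt_or_ge j 0 with hj | hj
  · rw [extendZero_of_neg _ hj, LinearMap.zero_apply, zero_add]
    rcases eq_or_ne j (-1) with rfl | hj'
    · rw [finsum_eq_single _ 0 fun i hi => by
        rw [hc _ (by lia) (by lia), map_zero]]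
      simp [extendZero]
    · rw [extendZero_of_neg _ (by lia), LinearMap.zero_apply]
      exact finsum_eq_zero_of_forall_eq_zero fun i => by
        rw [hc _ (by lia) (by lia), map_zero]
  · obtain ⟨n, rfl⟩ := Int.eq_ofNat_of_zero_le hj
    -- Only $i=n$, which meets $c_0$, and $i=n+1$, which meets $c_{-1}$, contribute.
    rw [finsum_eq_sum_of_support_subset (s := {n, n + 1}), Finset.sum_pair (by simp)]
    · have h1 : (n : ℤ) + 1 = (n + 1 : ℕ) := by push_cast; ring
      rw [h1, extendZero_natCast, extendZero_natCast]
      simp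
    · intro i hi
      by_contra h
      simp only [Finset.coe_insert, Finset.coe_singleton, mem_insert_iff, mem_singleton_iff,
        not_or] at h
      refine hi ?_
      change Ψ.A i x (c _) = 0
      rw [hc _ (by lia) (by lia), map_zero]

theorem act_constSeries (x : M) (a : K x) (j : ℤ) :
    Ψ.act x (constSeries a) j = extendZero (fun n => Ψ.A n x) j a := by
  rw [act_eq Ψ x (fun j h _ => constSeries_of_ne a h), constSeries_zero,
    constSeries_of_ne a (by simp), map_zero, add_zero]

theorem actSection_constSeries (a : ∀ x, K x) (j : ℤ) :
    Ψ.actSection (constSeries a) j = fun x => extendZero (fun n => Ψ.A n x) j (a x) := by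
  funext x
  unfold actSection
  simp only [constSeries_apply]
  exact act_constSeries Ψ x (a x) j

end FormalAutomorphism

theorem finsum_pairing_constSeries {W : Type*} [AddCommGroup W] [Module ℂ W]
    (g : W →ₗ[ℂ] W →ₗ[ℂ] ℂ) (r : ℤ) (a b : W) :
    ∑ᶠ p : ℤ, (-1 : ℂ) ^ (r - p) * g (constSeries a p) (constSeries b (r - p)) =
      if r = 0 then g a b else 0 := by
  rw [finsum_eq_single _ 0 fun p hp => by rw [constSeries_of_ne a hp]; simp, sub_zero,
    constSeries_zero]
  split_ifs with h
  · rw [h, constSeries_zero]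
    simp
  · rw [constSeries_of_ne b h]
    simp

theorem finsum_pairing_extendZero {W : Type*} [AddCommGroup W] [Module ℂ W]
    (g : W →ₗ[ℂ] W →ₗ[ℂ] ℂ) (A : ℕ → Module.End ℂ W) (a b : W)
    (hA : ∀ m, ∑ p ∈ Finset.HasAntidiagonal.antidiagonal m,
      (-1 : ℂ) ^ p.1 * g (A p.2 a) (A p.1 b) = if m = 0 then g a b else 0) (r : ℤ) :
    ∑ᶠ p : ℤ, (-1 : ℂ) ^ (r - p) * g (extendZero A p a) (extendZero A (r - p) b) =
      if r = 0 then g a b else 0 := by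
  have hzero : ∀ p : ℤ, (p < 0 ∨ r - p < 0) →
      (-1 : ℂ) ^ (r - p) * g (extendZero A p a) (extendZero A (r - p) b) = 0 := by
    rintro p (h | h) <;> rw [extendZero_of_neg _ h] <;> simp
  rcases lt_or_ge r 0 with hr | hr
  · rw [if_neg hr.ne]
    exact finsum_eq_zero_of_forall_eq_zero fun p => hzero p (by lia)
  · obtain ⟨n, rfl⟩ := Int.eq_ofNat_of_zero_le hr
    have h := hA n
    simp only [Nat.cast_eq_zero]
    -- In `hA` the sign belongs to the first index, which acts on the second argument of $g$; the
    -- swap matches this with $p$ indexing the first argument.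
    rw [← h, ← Finset.Nat.sum_antidiagonal_swap,
      Finset.Nat.sum_antidiagonal_eq_sum_range_succ_mk,
      finsum_eq_sum_of_support_subset (s := (Finset.range (n + 1)).map Nat.castEmbedding),
      Finset.sum_map]
    · refine Finset.sum_congr rfl fun k hk => ?_
      have hnk : (n : ℤ) - (Nat.castEmbedding k : ℤ) = (n - k : ℕ) := by
        rw [Nat.cast_sub (by simpa [Nat.lt_succ_iff] using hk)]
        rfl
      rw [hnk, extendZero_natCast, zpow_natCast]
      rfl
    · intro p hp
      by_contra hp'
      refine hp (hzero p ?_)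
      by_contra hcon
      push Not at hcon
      obtain ⟨k, rfl⟩ := Int.eq_ofNat_of_zero_le hcon.1
      refine hp' ?_
      simp only [Finset.coe_map, mem_image, Finset.mem_coe, Finset.mem_range]
      exact ⟨k, by lia, rfl⟩

end Series

/-! ### Derivatives of $\mathcal U$, $\mathcal Q$ and $\kappa\,\mathcal U\kappa$ in a CV-structure.
-/

section CV

set_option linter.unusedSectionVars false

variable {E : Type*} [NormedAddCommGroup E] [NormedSpace ℂ E]
  {M : Type*} [TopologicalSpace M] [ChartedSpace E M] [IsManifold 𝓘(ℂ, E) ω M]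
  {F : Type*} [NormedAddCommGroup F] [NormedSpace ℂ F] [FiniteDimensional ℂ F]
  {K : M → Type*} [TopologicalSpace (TotalSpace F K)]
  [∀ x, AddCommGroup (K x)] [∀ x, Module ℂ (K x)] [∀ x, TopologicalSpace (K x)]
  [∀ x, IsTopologicalAddGroup (K x)] [∀ x, ContinuousSMul ℂ (K x)]
  [FiberBundle F K] [VectorBundle ℂ F K] [ContMDiffVectorBundle ω F K 𝓘(ℂ, E)]

/-- Holomorphic endomorphisms commute with the `(0,1)`-part of a compatible connection. -/
theorem Connection.IsCompatible.dbar_apply {D : Connection E F K} (hD : D.IsCompatible)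
    {A : ∀ y, Module.End ℂ (K y)} (hA : IsHoloEnd E F A) {u : Set M} (hu : IsOpen u)
    {s : ∀ y, K y} (hs : SmoothOn E F s u) {x : M} (hx : x ∈ u) (X : TangentSpace 𝓘(ℂ, E) x) :
    D.dbar (fun y => A y (s y)) x X = A x (D.dbar s x X) := by
  have hder := D.isDerivationAt_dbar x X
  -- With $C=C'=0$ and a constant family the defect is $[D_{\bar X},A]$. Being tensorial, it can be
  -- evaluated on a holomorphic section with the same value at $x$, where both terms vanish.
  have hΦ := isTensorialAt_gaugeDefect (C := 0) (C' := 0) (A := fun _ => A) hder hder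
    (fun _ => hA.isSmoothEnd) 0
  obtain ⟨v, t, hv, hxv, ht, hts⟩ := exists_holoOn_eq E F x (s x)
  have h := hΦ.congr (hu.inter hv) ⟨hx, hxv⟩ (hs.mono inter_subset_left)
    ((smoothOn_of_holoOn hv ht).mono inter_subset_right) hts.symm
  simp only [gaugeDefect, LinearMap.zero_apply, map_zero, add_zero, sub_zero] at h
  rw [hD v t hv ht x hxv, hD v _ hv (hA v t hv ht) x hxv, map_zero, sub_zero, sub_eq_zero] at h
  exact h

theorem IsSmoothEnd.add {A B : ∀ y, Module.End ℂ (K y)} (hA : IsSmoothEnd E F A)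
    (hB : IsSmoothEnd E F B) : IsSmoothEnd E F (fun y => A y + B y) :=
  fun u s hu hs => (hA u s hu hs).add (hB u s hu hs)

theorem IsSmoothEnd.sub {A B : ∀ y, Module.End ℂ (K y)} (hA : IsSmoothEnd E F A)
    (hB : IsSmoothEnd E F B) : IsSmoothEnd E F (fun y => A y - B y) :=
  fun u s hu hs => (hA u s hu hs).sub (hB u s hu hs)

theorem IsSmoothEnd.mul {A B : ∀ y, Module.End ℂ (K y)} (hA : IsSmoothEnd E F A)
    (hB : IsSmoothEnd E F B) : IsSmoothEnd E F (fun y => A y * B y) :=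
  fun u s hu hs => hA u _ hu (hB u s hu hs)

theorem IsSmoothEnd.const_smul {A : ∀ y, Module.End ℂ (K y)} (hA : IsSmoothEnd E F A) (c : ℂ) :
    IsSmoothEnd E F (fun y => c • A y) :=
  fun u s hu hs => (hA u s hu hs).const_smul hu c

theorem isSmoothEnd_zero : IsSmoothEnd E F (fun y => (0 : Module.End ℂ (K y))) :=
  fun u _ _ _ => smoothOn_zero u

theorem isSmoothEnd_one : IsSmoothEnd E F (fun y => (1 : Module.End ℂ (K y))) :=
  fun _ _ _ hs => hs

namespace CVStructure

variable (T : CVStructure E F K)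

/-- The conjugate `κ B κ` of an endomorphism. -/
def conj (x : M) (B : Module.End ℂ (K x)) : Module.End ℂ (K x) where
  toFun a := T.κ x (B (T.κ x a))
  map_add' a b := by simp only [map_add]
  map_smul' c a := by simp only [map_smulₛₗ, Complex.conj_conj, RingHom.id_apply]

theorem conj_apply (x : M) (B : Module.End ℂ (K x)) (a : K x) :
    T.conj x B a = T.κ x (B (T.κ x a)) := rfl

theorem isSmoothEnd_conj {B : ∀ y, Module.End ℂ (K y)} (hB : IsSmoothEnd E F B) :
    IsSmoothEnd E F (fun y => T.conj y (B y)) :=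
  fun u s hu hs => T.κ_smooth u _ hu (hB u _ hu (T.κ_smooth u s hu hs))

theorem g_κ_left (x : M) (a b : K x) :
    T.g x (T.κ x a) b = starRingEnd ℂ (T.g x a (T.κ x b)) := by
  rw [← T.g_κ, T.κ_invol]

theorem g_conj {x : M} {B : Module.End ℂ (K x)} (hB : ∀ a b, T.g x (B a) b = T.g x a (B b))
    (a b : K x) : T.g x (T.conj x B a) b = T.g x a (T.conj x B b) := by
  rw [conj_apply, conj_apply, g_κ_left, hB, ← T.g_κ, T.κ_invol]

/-- Since $h=g(\cdot,\kappa\,\cdot)$, an endomorphism that is $h$-hermitian and $g$-skew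
anticommutes with $\kappa$. Consequently $\kappa\mathcal Q\kappa=-\mathcal Q$. -/
theorem κ_Q (x : M) (a : K x) : T.κ x (T.Q x a) = - T.Q x (T.κ x a) := by
  rw [eq_neg_iff_add_eq_zero]
  refine T.g_nondeg x _ fun b => ?_
  have h := T.Q_herm x b a
  rw [T.h_eq, T.h_eq, T.Q_skew] at h
  rw [T.g_symm, map_add, ← h, neg_add_cancel]

theorem isSkew_Q (x : M) : IsSkew (T.g x) (T.Q x) := T.Q_skew x

theorem simpleSymmetric (hT : T.IsSemisimple) (x : M) : SimpleSymmetric (T.g x) (T.U x) where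
  card := by rw [hT x, finrank_fiber F x]
  g_symm := T.g_symm x
  g_nondeg := T.g_nondeg x
  g_U := T.g_U x

section Derivatives

variable {T} {u : Set M} {s : ∀ y, K y} {x : M}

theorem isMetric_D : T.D.IsMetric T.g := by
  intro u s t hu hs ht x hx v
  have h := T.D_h u s _ hu hs (T.κ_smooth u t hu ht) x hx v
  rw [T.D_κ u t hu ht x hx v] at h
  simpa only [T.h_eq, T.κ_invol] using h

/-- $\kappa$ is parallel and antilinear, so moving it past $i$ exchanges $D_X$ and $D_{\bar X}$. The
$(0,1)$-equations below thus come from the $(1,0)$-axioms by conjugation. -/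
theorem d_κ (hu : IsOpen u) (hs : SmoothOn E F s u) (hx : x ∈ u) (X : TangentSpace 𝓘(ℂ, E) x) :
    T.D.d (fun y => T.κ y (s y)) x X = T.κ x (T.D.dbar s x X) := by
  simp only [Connection.d, Connection.dbar, T.D_κ u s hu hs x hx, map_smulₛₗ, map_add]
  simp [Complex.conj_ofNat]
  module

theorem dbar_κ (hu : IsOpen u) (hs : SmoothOn E F s u) (hx : x ∈ u)
    (X : TangentSpace 𝓘(ℂ, E) x) :
    T.D.dbar (fun y => T.κ y (s y)) x X = T.κ x (T.D.d s x X) := by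
  simp only [Connection.d, Connection.dbar, T.D_κ u s hu hs x hx, map_smulₛₗ, map_sub]
  simp [Complex.conj_ofNat]

theorem d_U (hu : IsOpen u) (hs : SmoothOn E F s u) (hx : x ∈ u) (X : TangentSpace 𝓘(ℂ, E) x) :
    T.D.d (fun y => T.U y (s y)) x X = T.U x (T.D.d s x X) + T.C x X (T.Q x (s x)) -
      T.Q x (T.C x X (s x)) - T.C x X (s x) := by
  linear_combination (norm := module) T.D_U u s hu hs x hx X

theorem d_Q (hu : IsOpen u) (hs : SmoothOn E F s u) (hx : x ∈ u) (X : TangentSpace 𝓘(ℂ, E) x) :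
    T.D.d (fun y => T.Q y (s y)) x X = T.Q x (T.D.d s x X) +
      T.conj x (T.U x) (T.C x X (s x)) - T.C x X (T.conj x (T.U x) (s x)) := by
  simp only [conj_apply]
  linear_combination (norm := module) T.D_Q u s hu hs x hx X

/-- The conjugate of $D_{\bar X}(\mathcal U)=0$. -/
theorem d_conj_U (hu : IsOpen u) (hs : SmoothOn E F s u) (hx : x ∈ u)
    (X : TangentSpace 𝓘(ℂ, E) x) :
    T.D.d (fun y => T.conj y (T.U y) (s y)) x X = T.conj x (T.U x) (T.D.d s x X) := by
  have h1 := T.κ_smooth u s hu hs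
  have h2 := T.U_holo.isSmoothEnd u _ hu h1
  refine (d_κ hu h2 hx X).trans ?_
  rw [T.D_compatible.dbar_apply T.U_holo hu h1 hx, dbar_κ hu hs hx]
  rfl

theorem dbar_U (hu : IsOpen u) (hs : SmoothOn E F s u) (hx : x ∈ u)
    (X : TangentSpace 𝓘(ℂ, E) x) :
    T.D.dbar (fun y => T.U y (s y)) x X = T.U x (T.D.dbar s x X) :=
  T.D_compatible.dbar_apply T.U_holo hu hs hx X

/-- The conjugate of the equation for $D_X(\mathcal Q)$, with $\mathcal Q=-\kappa\mathcal Q\kappa$.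
-/
theorem dbar_Q (hu : IsOpen u) (hs : SmoothOn E F s u) (hx : x ∈ u)
    (X : TangentSpace 𝓘(ℂ, E) x) :
    T.D.dbar (fun y => T.Q y (s y)) x X = T.Q x (T.D.dbar s x X) -
      T.U x (T.conj x (T.C x X) (s x)) + T.conj x (T.C x X) (T.U x (s x)) := by
  have h1 := T.κ_smooth u s hu hs
  have h2 := T.Q_smooth u _ hu h1
  have h3 : (fun y => T.Q y (s y)) = (-1 : ℂ) • fun y => T.κ y (T.Q y (T.κ y (s y))) := by
    funext y
    rw [Pi.smul_apply, κ_Q, T.κ_invol]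
    module
  rw [h3, (T.D.isDerivationAt_dbar x X).csmul _ u _ hu hx (T.κ_smooth u _ hu h2),
    dbar_κ hu h2 hx, d_Q hu h1 hx, d_κ hu hs hx]
  simp only [conj_apply, map_add, map_sub, T.κ_invol, κ_Q]
  module

/-- The conjugate of the equation for $D_X(\mathcal U)$; the commutator with $\mathcal Q$ changes
sign because $\kappa\mathcal Q\kappa=-\mathcal Q$. -/
theorem dbar_conj_U (hu : IsOpen u) (hs : SmoothOn E F s u) (hx : x ∈ u)
    (X : TangentSpace 𝓘(ℂ, E) x) :
    T.D.dbar (fun y => T.conj y (T.U y) (s y)) x X = T.conj x (T.U x) (T.D.dbar s x X) -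
      T.conj x (T.C x X) (s x) + T.Q x (T.conj x (T.C x X) (s x)) -
      T.conj x (T.C x X) (T.Q x (s x)) := by
  have h1 := T.κ_smooth u s hu hs
  have h2 := T.U_holo.isSmoothEnd u _ hu h1
  refine (dbar_κ hu h2 hx X).trans ?_
  rw [d_U hu h1 hx, d_κ hu hs hx]
  simp only [conj_apply, map_add, map_sub, map_neg, κ_Q]
  module

end Derivatives

end CVStructure

end CV

end

end TTStar
namespace TTStar

noncomputable section

/-! ### The equations for $\Psi$ in coefficients, and the smooth formal solution. -/

section Main

set_option linter.unusedSectionVars false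

variable {E : Type*} [NormedAddCommGroup E] [NormedSpace ℂ E]
  {M : Type*} [TopologicalSpace M] [ChartedSpace E M] [IsManifold 𝓘(ℂ, E) ω M]
  {F : Type*} [NormedAddCommGroup F] [NormedSpace ℂ F] [FiniteDimensional ℂ F]
  {K : M → Type*} [TopologicalSpace (TotalSpace F K)]
  [∀ x, AddCommGroup (K x)] [∀ x, Module ℂ (K x)] [∀ x, TopologicalSpace (K x)]
  [∀ x, IsTopologicalAddGroup (K x)] [∀ x, ContinuousSMul ℂ (K x)]
  [FiberBundle F K] [VectorBundle ℂ F K] [ContMDiffVectorBundle ω F K 𝓘(ℂ, E)]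

/-- The coefficients of `Ψ`, extended by zero to negative indices. -/
def FormalAutomorphism.coeff (Ψ : FormalAutomorphism E F K) (j : ℤ) (y : M) :
    Module.End ℂ (K y) := extendZero (fun n => Ψ.A n y) j

theorem FormalAutomorphism.coeff_of_neg (Ψ : FormalAutomorphism E F K) {j : ℤ} (hj : j < 0)
    (y : M) : Ψ.coeff j y = 0 := extendZero_of_neg _ hj

theorem FormalAutomorphism.coeff_zero (Ψ : FormalAutomorphism E F K) (y : M) : Ψ.coeff 0 y = 1 :=
  Ψ.A_zero y

theorem FormalAutomorphism.isSmoothEnd_coeff (Ψ : FormalAutomorphism E F K) (j : ℤ) :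
    IsSmoothEnd E F (Ψ.coeff j) := by
  rcases lt_or_ge j 0 with hj | hj
  · have : Ψ.coeff j = fun y => 0 := funext fun y => Ψ.coeff_of_neg hj y
    rw [this]
    exact isSmoothEnd_zero
  · obtain ⟨n, rfl⟩ := Int.eq_ofNat_of_zero_le hj
    have : Ψ.coeff n = Ψ.A n := funext fun y => extendZero_natCast _ n
    rw [this]
    exact Ψ.A_smooth n

theorem Connection.d_zero (D : Connection E F K) (x : M) (X : TangentSpace 𝓘(ℂ, E) x) :
    D.d 0 x X = 0 := (D.isDerivationAt_d x X).map_zero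

theorem Connection.dbar_zero (D : Connection E F K) (x : M) (X : TangentSpace 𝓘(ℂ, E) x) :
    D.dbar 0 x X = 0 := (D.isDerivationAt_dbar x X).map_zero

namespace FormalAutomorphism

variable (Ψ : FormalAutomorphism E F K) (S : SaitoStructure E F K) (T : CVStructure E F K)
  (w : ℤ) (a : ∀ y, K y) (x : M) (X : TangentSpace 𝓘(ℂ, E) x) (j : ℤ)

theorem act_nabla : Ψ.act x (S.nabla (constSeries a) x X) j =
    Ψ.coeff j x (S.conn.d a x X) + Ψ.coeff (j + 1) x (S.C x X (a x)) := by
  rw [act_eq Ψ x fun j h h' => ?_]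
  · simp [SaitoStructure.nabla, constSeries_zero, constSeries_of_ne, Connection.d_zero, coeff]
  · rw [SaitoStructure.nabla, constSeries_of_ne a h, constSeries_of_ne a (by lia),
      Connection.d_zero]
    simp

theorem act_nablaBar : Ψ.act x (S.nablaBar (constSeries a) x X) j =
    Ψ.coeff j x (S.conn.dbar a x X) := by
  rw [act_eq Ψ x fun j h h' => ?_]
  · simp [SaitoStructure.nablaBar, constSeries_zero, constSeries_of_ne, Connection.dbar_zero, coeff]
  · rw [SaitoStructure.nablaBar, constSeries_of_ne a h, Connection.dbar_zero]

theorem act_zdz : Ψ.act x (S.zdz w (constSeries a) x) j =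
    Ψ.coeff j x (((w : ℂ) / 2) • a x - S.V x (a x)) + Ψ.coeff (j + 1) x (S.U x (a x)) := by
  rw [act_eq Ψ x fun j h h' => ?_]
  · simp [SaitoStructure.zdz, constSeries_zero, constSeries_of_ne, coeff]
    abel
  · rw [SaitoStructure.zdz, constSeries_of_ne a h, constSeries_of_ne a (by lia)]
    simp

theorem nabla_actSection : T.nabla (Ψ.actSection (constSeries a)) x X j =
    T.D.d (fun y => Ψ.coeff j y (a y)) x X + T.C x X (Ψ.coeff (j + 1) x (a x)) := by
  rw [CVStructure.nabla, actSection_constSeries, actSection_constSeries]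
  rfl

theorem nablaBar_actSection : T.nablaBar (Ψ.actSection (constSeries a)) x X j =
    T.D.dbar (fun y => Ψ.coeff j y (a y)) x X +
      T.conj x (T.C x X) (Ψ.coeff (j - 1) x (a x)) := by
  rw [CVStructure.nablaBar, actSection_constSeries, actSection_constSeries]
  rfl

theorem zdz_actSection : T.zdz w (Ψ.actSection (constSeries a)) x j =
    (j : ℂ) • Ψ.coeff j x (a x) + T.U x (Ψ.coeff (j + 1) x (a x)) - T.Q x (Ψ.coeff j x (a x)) +
      ((w : ℂ) / 2) • Ψ.coeff j x (a x) - T.conj x (T.U x) (Ψ.coeff (j - 1) x (a x)) := by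
  rw [CVStructure.zdz, actSection_constSeries, actSection_constSeries, actSection_constSeries]
  rfl

end FormalAutomorphism

variable {S : SaitoStructure E F K} {T : CVStructure E F K} {w : ℤ}

theorem HiggsData.pairing_constSeries (H : HiggsData E F K) (w : ℤ) (x : M) (a b : K x) (m : ℤ) :
    H.pairing w x (constSeries a) (constSeries b) m = if m - w = 0 then H.g x a b else 0 :=
  finsum_pairing_constSeries (H.g x) (m - w) a b

/-- In each congruence the lowest coefficient involves only $A_0=1$: $z^{-1}$ for $\nabla_X$ and
$\nabla_{z\partial_z}$, $z^w$ for the pairing and $z^0$ for $\nabla_{\bar X}$. -/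
theorem ACondition.higgs_eq (hA : ACondition S T w (-1 : ℤ)) :
    S.C = T.C ∧ S.U = T.U ∧ S.g = T.g ∧
      ∀ (u : Set M) (a : ∀ y, K y), IsOpen u → SmoothOn E F a u → ∀ x ∈ u, ∀ X,
        T.D.dbar a x X = S.conn.dbar a x X := by
  obtain ⟨Ψ, h1, h2⟩ := hA
  have hzero : ∀ a : ∀ y, K y, (fun y => Ψ.coeff (-1) y (a y)) = 0 := fun a => funext fun y => by
    rw [Ψ.coeff_of_neg (by simp)]
    rfl
  refine ⟨?_, ?_, ?_, ?_⟩
  · funext x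
    ext X v
    obtain ⟨u, a, hu, hx, ha, rfl⟩ := exists_holoOn_eq E F x v
    have h := (h1 u a hu (smoothOn_of_holoOn hu ha) x hx).1 X (-1) le_rfl
    rw [Ψ.nabla_actSection, Ψ.act_nabla, hzero, Connection.d_zero,
      Ψ.coeff_of_neg (show (-1 : ℤ) < 0 by simp)] at h
    simpa [Ψ.coeff_zero] using h.symm
  · funext x
    ext v
    obtain ⟨u, a, hu, hx, ha, rfl⟩ := exists_holoOn_eq E F x v
    have h := (h1 u a hu (smoothOn_of_holoOn hu ha) x hx).2.1 (-1) le_rfl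
    rw [Ψ.zdz_actSection, Ψ.act_zdz, Ψ.coeff_of_neg (show (-1 : ℤ) < 0 by simp),
      Ψ.coeff_of_neg (show (-1 : ℤ) - 1 < 0 by simp)] at h
    simpa [Ψ.coeff_zero] using h.symm
  · funext x
    ext a b
    -- After the shift by $w+1$ the index $-1$ is the coefficient of $z^w$, to which only $p=0$
    -- contributes.
    have h := h2 x a b (-1) le_rfl
    simp only at h
    rw [HiggsData.pairing_constSeries, HiggsData.pairing, if_pos (by ring),
      finsum_eq_single _ 0] at h
    · simpa [FormalAutomorphism.act_constSeries, extendZero, Ψ.A_zero] using h.symm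
    · intro p hp
      rw [Ψ.act_constSeries, Ψ.act_constSeries]
      rcases lt_or_gt_of_ne hp with hp | hp
      · rw [extendZero_of_neg _ hp]
        simp
      · rw [extendZero_of_neg (fun n => Ψ.A n x) (show -1 + w + 1 - w - p < 0 by lia)]
        simp
  · intro u a hu ha x hx X
    -- For $\bar X$ the congruence reaches one order further, so at $k=-1$ the coefficient of $z^0$
    -- is available.
    have h := (h1 u a hu ha x hx).2.2 X 0 (by norm_cast)
    rw [Ψ.nablaBar_actSection, Ψ.act_nablaBar, Ψ.coeff_of_neg (by simp)] at h
    simpa [Ψ.coeff_zero] using h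

/-- The smooth formal solution of the equation along `z ∂_z`. -/
theorem CVStructure.exists_formal_solution (hT : T.IsSemisimple) {V : ∀ y, Module.End ℂ (K y)}
    (hV : ∀ y, IsSkew (T.g y) (V y)) (hV' : IsSmoothEnd E F V) :
    ∃ Ψ : FormalAutomorphism E F K, ∀ y, Intertwines (T.U y) (T.Q y) (V y) (T.conj y (T.U y)) 0
      (fun j => Ψ.coeff j y) := by
  have hfin : ∀ y, FiniteDimensional ℂ (K y) := fun y =>
    (frameBasis F y (FiberBundle.mem_baseSet_trivializationAt F K y)).finiteDimensional_of_finite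
  have hex := fun y => exists_intertwines (T.simpleSymmetric hT y) (T.isSkew_Q y) (hV y)
    (T.conj y (T.U y)) 0
  -- The solutions are chosen independently at each point; smoothness follows because each
  -- coefficient is determined by the previous two.
  choose B hB0 hB using hex
  have hU' := T.U_holo.isSmoothEnd
  have hS' := T.isSmoothEnd_conj hU'
  have hsm : ∀ n : ℕ, IsSmoothEnd E F (fun y => extendZero (B y) ((n : ℤ) - 1)) ∧
      IsSmoothEnd E F (fun y => B y n) := by
    intro n
    induction n with
    | zero =>
      refine ⟨?_, ?_⟩
      · simp only [extendZero_of_neg _ (show ((0 : ℕ) : ℤ) - 1 < 0 by simp)]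
        exact isSmoothEnd_zero
      · simp only [hB0]
        exact isSmoothEnd_one
    | succ n ih =>
      have hn : ((n + 1 : ℕ) : ℤ) - 1 = n := by push_cast; ring
      have hn' : (n : ℤ) + 1 = (n + 1 : ℕ) := by push_cast; ring
      simp only [hn, extendZero_natCast]
      refine ⟨ih.2, ?_⟩
      have hc : ((n + 1 : ℕ) : ℂ) ≠ 0 := Nat.cast_ne_zero.2 n.succ_ne_zero
      -- Relation $n$ prescribes $[\mathcal U,A_{n+1}]$, and relation $n+1$ supplies the trace
      -- normalization, as its top term is a commutator with $\mathcal U$.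
      refine isSmoothEnd_of_commutator_eq (R := fun y => T.Q y * B y n - (n : ℂ) • B y n -
          B y n * V y + T.conj y (T.U y) * extendZero (B y) ((n : ℤ) - 1))
        (T.simpleSymmetric hT) T.isSkew_Q hV hc hU' T.Q_smooth hV'
        ((((T.Q_smooth.mul ih.2).sub (ih.2.const_smul _)).sub (ih.2.mul hV')).add (hS'.mul ih.1))
        (hS'.mul ih.2) (fun y => ?_) (fun y => ?_)
      · have h := hB y n
        rw [hn', extendZero_natCast, extendZero_natCast, mul_zero, add_zero] at h
        rw [← sub_eq_zero, ← h, Int.cast_natCast]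
        abel
      · have h := hB y (n + 1 : ℕ)
        rw [hn, extendZero_natCast, extendZero_natCast, mul_zero, add_zero] at h
        have h2 : ((n + 1 : ℕ) : ℂ) • B y (n + 1) - T.Q y * B y (n + 1) + B y (n + 1) * V y -
            T.conj y (T.U y) * B y n = -(T.U y * extendZero (B y) ((n + 1 : ℕ) + 1) -
              extendZero (B y) ((n + 1 : ℕ) + 1) * T.U y) := by
          rw [eq_neg_iff_add_eq_zero, ← h, Int.cast_natCast]
          abel
        rw [h2]
        exact (traceOrth_commutator (Commute.refl _) _).neg
  exact ⟨⟨fun n y => B y n, hB0, fun n => (hsm n).2⟩, hB⟩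

theorem gaugeDefect_eq_zero_of_lt (Ψ : FormalAutomorphism E F K) {x : M} {σ : (M → ℝ) → ℂ}
    {D N : (∀ y, K y) → K x} {C C' : Module.End ℂ (K x)} (hD : IsDerivationAt E F x σ D)
    {j : ℤ} (hj : j < 0) (a : ∀ y, K y) : gaugeDefect D N C C' Ψ.coeff j a = 0 := by
  have h0 : (fun y => Ψ.coeff j y (a y)) = 0 := funext fun y => by
    rw [Ψ.coeff_of_neg hj]
    rfl
  rw [gaugeDefect, h0, hD.map_zero, Ψ.coeff_of_neg hj, Ψ.coeff_of_neg (show j - 1 < 0 by lia)]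
  rcases eq_or_ne j (-1) with rfl | hj'
  · rw [show (-1 : ℤ) + 1 = 0 by simp, Ψ.coeff_zero]
    simp
  · rw [Ψ.coeff_of_neg (show j + 1 < 0 by lia)]
    simp

/-- The gauge defect of the formal solution vanishes if its leading coefficient is orthogonal to
the powers of `U`. -/
theorem gaugeDefect_eq_zero (hT : T.IsSemisimple) {V : ∀ y, Module.End ℂ (K y)}
    (hV : ∀ y, IsSkew (T.g y) (V y)) (Ψ : FormalAutomorphism E F K) {x : M} {σ : (M → ℝ) → ℂ}
    {D N : (∀ y, K y) → K x} {C C' : Module.End ℂ (K x)} (hD : IsDerivationAt E F x σ D)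
    {B : ℤ → Module.End ℂ (K x)}
    (hB : ∀ (j : ℤ) (u : Set M) (s : ∀ y, K y), IsOpen u → x ∈ u →
      SmoothOn E F s u → gaugeDefect D N C C' Ψ.coeff j s = B j (s x))
    (hint : Intertwines (T.U x) (T.Q x) (V x) (T.conj x (T.U x)) 0 B)
    (h0 : TraceOrth (T.U x) (B 0)) {u : Set M} (hu : IsOpen u) (hx : x ∈ u) {a : ∀ y, K y}
    (ha : SmoothOn E F a u) (j : ℤ) : gaugeDefect D N C C' Ψ.coeff j a = 0 := by
  have hfin : FiniteDimensional ℂ (K x) :=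
    (frameBasis F x (FiberBundle.mem_baseSet_trivializationAt F K x)).finiteDimensional_of_finite
  have hneg : ∀ j < 0, B j = 0 := fun j hj => by
    ext v
    obtain ⟨u, s, hu, hx, hs, rfl⟩ := exists_holoOn_eq E F x v
    rw [← hB j u s hu hx (smoothOn_of_holoOn hu hs), gaugeDefect_eq_zero_of_lt Ψ hD hj]
    rfl
  have hg := T.simpleSymmetric hT x
  have hB0 : B 0 = 0 := by
    refine eq_zero_of_commute_of_traceOrth hg ?_ h0
    -- With the negative coefficients zero, the relation at $-1$ reads $[\mathcal U,B_0]=0$.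
    have h := hint (-1)
    rw [hneg (-1) (by simp), hneg (-1 - 1) (by simp)] at h
    simpa using h
  rcases lt_or_ge j 0 with hj | hj
  · exact gaugeDefect_eq_zero_of_lt Ψ hD hj a
  · obtain ⟨n, rfl⟩ := Int.eq_ofNat_of_zero_le hj
    rw [hB n u a hu hx ha, hint.eq_zero hg (T.isSkew_Q x) (hV x) (hneg _ (by simp)) hB0 n]
    rfl

/-! ### The formal solution satisfies all equations and yields the potential. -/

section Solution

variable (hT : T.IsSemisimple) (hC : S.C = T.C) (hU : S.U = T.U) (hg : S.g = T.g)
  {Ψ : FormalAutomorphism E F K}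
  (hΨ : ∀ y, Intertwines (T.U y) (T.Q y) (S.V y) (T.conj y (T.U y)) 0 (fun j => Ψ.coeff j y))
  {u : Set M} {a : ∀ y, K y} {x : M}

theorem isSkew_V (hg : S.g = T.g) (y : M) : IsSkew (T.g y) (S.V y) := fun a b => by
  rw [← hg]
  exact eq_neg_of_add_eq_zero_left (S.V_skew y a b)

/-- The difference of two metric connections is skew. -/
theorem isSkew_of_isMetric {D N : Connection E F K} {g : ∀ y, K y →ₗ[ℂ] K y →ₗ[ℂ] ℂ}
    (hD : D.IsMetric g) (hN : N.IsMetric g) (X : TangentSpace 𝓘(ℂ, E) x)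
    {W : Module.End ℂ (K x)}
    (hW : ∀ (u : Set M) (s : ∀ y, K y), IsOpen u → x ∈ u → SmoothOn E F s u →
      W (s x) = D.d s x X - N.d s x X) : IsSkew (g x) W := by
  intro v v'
  obtain ⟨u, s, hu, hx, hs, rfl⟩ := exists_holoOn_eq E F x v
  obtain ⟨u', t, hu', hx', ht, rfl⟩ := exists_holoOn_eq E F x v'
  have hs' := (smoothOn_of_holoOn hu hs).mono (inter_subset_left : u ∩ u' ⊆ u)
  have ht' := (smoothOn_of_holoOn hu' ht).mono (inter_subset_right : u ∩ u' ⊆ u')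
  have hi := hu.inter hu'
  rw [hW _ s hi ⟨hx, hx'⟩ hs', hW _ t hi ⟨hx, hx'⟩ ht']
  have h := fun v => (hD _ s t hi hs' ht' x ⟨hx, hx'⟩ v).symm.trans
    (hN _ s t hi hs' ht' x ⟨hx, hx'⟩ v)
  have h1 := h (realVector X)
  have h2 := h (realVector (Complex.I • X))
  simp only [Connection.d, map_sub, map_smul, LinearMap.sub_apply, LinearMap.smul_apply,
    smul_eq_mul]
  linear_combination (1 / 2 : ℂ) * h1 - (1 / 2 : ℂ) * Complex.I * h2

-- The axioms of the two structures say that $\nabla_X$ and $\widehat\nabla_X$ commute with their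
-- $z\partial_z$-derivatives, so the defect is an intertwiner. Its constant term is
-- $(D_X-\nabla^r_X)+[C_X,A_1]$: a skew term plus a commutator with $C_X$, which commutes with
-- $\mathcal U$. Both have zero diagonal.
include hT hC hU hg hΨ in
theorem gaugeDefect_d_eq_zero (hu : IsOpen u) (hx : x ∈ u) (ha : SmoothOn E F a u)
    (X : TangentSpace 𝓘(ℂ, E) x) (j : ℤ) :
    gaugeDefect (fun s => T.D.d s x X) (fun s => S.conn.d s x X) (T.C x X) 0 Ψ.coeff j a = 0 := by
  have hD := T.D.isDerivationAt_d x X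
  have hN := S.conn.isDerivationAt_d x X
  have hU' := T.U_holo.isSmoothEnd
  obtain ⟨B, hB⟩ := exists_gaugeDefect_eq (C := T.C x X) (C' := 0) hD hN Ψ.isSmoothEnd_coeff
  refine gaugeDefect_eq_zero hT (isSkew_V hg) Ψ hD hB ?_ ?_ hu hx ha j
  · refine intertwines_gaugeDefect hD Ψ.isSmoothEnd_coeff hU' T.Q_smooth
      S.V_holo.isSmoothEnd (T.isSmoothEnd_conj hU') hΨ
      (fun u s hu hx hs => CVStructure.d_U hu hs hx X) (fun u s hu hx hs => ?_)
      (fun u s hu hx hs => ?_) (fun u s hu hx hs => ?_)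
      (fun u s hu hx hs => sub_eq_zero.1 (S.V_parallel u s hu hs x hx X)) (fun v => ?_)
      (fun v => by simp) hB
    · rw [CVStructure.d_Q hu hs hx]
      simp
    · rw [CVStructure.d_conj_U hu hs hx]
      simp
    · have h := S.conn_U u s hu hs x hx X
      rw [hU, hC] at h
      linear_combination (norm := module) h
    · exact (congrArg (fun B : Module.End ℂ (K x) => B v) (T.C_comm_U x X)).symm
  · have hW : IsSkew (T.g x)
        (B 0 - (T.C x X * Ψ.coeff 1 x - Ψ.coeff 1 x * T.C x X)) := by
      refine isSkew_of_isMetric CVStructure.isMetric_D (hg ▸ S.conn_g) X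
        fun u s hu hx hs => ?_
      rw [LinearMap.sub_apply, ← hB 0 u s hu hx hs, gaugeDefect]
      simp [Ψ.coeff_zero]
    have hfin : FiniteDimensional ℂ (K x) :=
      (frameBasis F x (FiberBundle.mem_baseSet_trivializationAt F K x)).finiteDimensional_of_finite
    have h := (hW.traceOrth (T.simpleSymmetric hT x)).add
      (traceOrth_commutator (show Commute (T.U x) (T.C x X) from (T.C_comm_U x X).symm)
        (Ψ.coeff 1 x))
    rwa [sub_add_cancel] at h

-- As for type $(1,0)$, with the conjugated axioms. Here the constant term of the defect is $D_{\bar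
-- X}-\bar\partial_{\bar X}=0$.
include hT hU hg hΨ in
theorem gaugeDefect_dbar_eq_zero
    (hbar : ∀ (u : Set M) (a : ∀ y, K y), IsOpen u → SmoothOn E F a u → ∀ x ∈ u, ∀ X,
      T.D.dbar a x X = S.conn.dbar a x X)
    (hu : IsOpen u) (hx : x ∈ u) (ha : SmoothOn E F a u)
    (X : TangentSpace 𝓘(ℂ, E) x) (j : ℤ) :
    gaugeDefect (fun s => T.D.dbar s x X) (fun s => S.conn.dbar s x X) 0 (T.conj x (T.C x X))
      Ψ.coeff j a = 0 := by
  have hD := T.D.isDerivationAt_dbar x X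
  have hN := S.conn.isDerivationAt_dbar x X
  have hU' := T.U_holo.isSmoothEnd
  obtain ⟨B, hB⟩ := exists_gaugeDefect_eq (C := 0) (C' := T.conj x (T.C x X)) hD hN
    Ψ.isSmoothEnd_coeff
  refine gaugeDefect_eq_zero hT (isSkew_V hg) Ψ hD hB ?_ ?_ hu hx ha j
  · refine intertwines_gaugeDefect hD Ψ.isSmoothEnd_coeff hU' T.Q_smooth
      S.V_holo.isSmoothEnd (T.isSmoothEnd_conj hU') hΨ
      (fun u s hu hx hs => ?_) (fun u s hu hx hs => ?_)
      (fun u s hu hx hs => CVStructure.dbar_conj_U hu hs hx X) (fun u s hu hx hs => ?_)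
      (fun u s hu hx hs => S.conn_compatible.dbar_apply S.V_holo hu hs hx X) (fun v => by simp)
      (fun v => ?_) hB
    · rw [CVStructure.dbar_U hu hs hx]
      simp
    · rw [CVStructure.dbar_Q hu hs hx]
      simp
    · have h := S.conn_compatible.dbar_apply S.U_holo hu hs hx X
      rw [hU] at h
      rw [h]
      simp
    · have h := congrArg (fun B : Module.End ℂ (K x) => B (T.κ x v)) (T.C_comm_U x X)
      simp only [Module.End.mul_apply] at h
      simp only [CVStructure.conj_apply, T.κ_invol, h]
  · have hB0 : B 0 = 0 := by
      ext v
      obtain ⟨u, s, hu, hx, hs, rfl⟩ := exists_holoOn_eq E F x v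
      replace hs := smoothOn_of_holoOn hu hs
      rw [← hB 0 u s hu hx hs, gaugeDefect, Ψ.coeff_of_neg (show (0 : ℤ) - 1 < 0 by simp)]
      simp [Ψ.coeff_zero, hbar u s hu hs x hx X]
    rw [hB0]
    intro k
    rw [mul_zero, map_zero]

include hT hg hΨ in
theorem formalSolution_isometry (m : ℕ) (x : M) (a b : K x) :
    ∑ p ∈ Finset.HasAntidiagonal.antidiagonal m,
      (-1 : ℂ) ^ p.1 * T.g x (Ψ.A p.2 x a) (Ψ.A p.1 x b) = if m = 0 then T.g x a b else 0 := by
  have hfin : FiniteDimensional ℂ (K x) :=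
    (frameBasis F x (FiberBundle.mem_baseSet_trivializationAt F K x)).finiteDimensional_of_finite
  exact (hΨ x).isometry (A := fun n => Ψ.A n x) (T.simpleSymmetric hT x) (T.isSkew_Q x)
    (isSkew_V hg x) (fun a b => T.g_conj (T.g_U x) a b) (by simp) (Ψ.A_zero x) m a b

-- All coefficients agree, so the bound on the order plays no role and the same $\Psi$ serves every
-- $k$, including $\infty$.
include hT hC hU hg hΨ in
theorem aCondition_of_formalSolution
    (hbar : ∀ (u : Set M) (a : ∀ y, K y), IsOpen u → SmoothOn E F a u → ∀ x ∈ u, ∀ X,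
      T.D.dbar a x X = S.conn.dbar a x X) (k : WithTop ℤ) : ACondition S T w k := by
  refine ⟨Ψ, fun u a hu ha x hx => ⟨fun X j _ => ?_, fun j _ => ?_, fun X j _ => ?_⟩,
    fun x a b j _ => ?_⟩
  · have h := gaugeDefect_d_eq_zero hT hC hU hg hΨ hu hx ha X j
    rw [gaugeDefect, LinearMap.zero_apply, add_zero] at h
    rw [Ψ.nabla_actSection, Ψ.act_nabla, hC]
    linear_combination (norm := module) h
  · have h := congrArg (fun B : Module.End ℂ (K x) => B (a x)) (hΨ x j)
    simp only [mul_zero, add_zero, LinearMap.add_apply, LinearMap.sub_apply, LinearMap.smul_apply,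
      Module.End.mul_apply, LinearMap.zero_apply] at h
    rw [Ψ.zdz_actSection, Ψ.act_zdz, hU, map_sub, map_smul]
    linear_combination (norm := module) h
  · have h := gaugeDefect_dbar_eq_zero hT hU hg hΨ hbar hu hx ha X j
    rw [gaugeDefect] at h
    simp only [LinearMap.zero_apply, map_zero, add_zero, sub_zero] at h
    rw [Ψ.nablaBar_actSection, Ψ.act_nablaBar]
    linear_combination (norm := module) h
  · have h := finsum_pairing_extendZero (T.g x) (fun n => Ψ.A n x) a b
      (fun m => formalSolution_isometry hT hg hΨ m x a b) (j + w + 1 - w)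
    simp only [HiggsData.pairing_constSeries, hg]
    rw [← h]
    simp only [HiggsData.pairing, Ψ.act_constSeries]

include hT hC hU hg hΨ in
theorem isHarmonicPotential_of_formalSolution
    (hbar : ∀ (u : Set M) (a : ∀ y, K y), IsOpen u → SmoothOn E F a u → ∀ x ∈ u, ∀ X,
      T.D.dbar a x X = S.conn.dbar a x X) : IsHarmonicPotential S T := by
  -- The isometry relation at $z^1$ is $g(A_1a,b)-g(a,A_1b)=0$.
  have hsymm : ∀ x a b, T.g x (Ψ.A 1 x a) b = T.g x a (Ψ.A 1 x b) := fun x a b => by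
    have h := formalSolution_isometry hT hg hΨ 1 x a b
    rw [Finset.Nat.sum_antidiagonal_eq_sum_range_succ_mk] at h
    simp [Finset.sum_range_succ, Ψ.A_zero] at h
    linear_combination h
  have hone : ∀ y, Ψ.coeff 1 y = Ψ.A 1 y := fun y => rfl
  -- The witnesses are $A^\flat=-A_1$ and its $h$-adjoint $A=-\kappa A_1\kappa$. The equations for
  -- $D$ and $\mathcal Q$ are the $z^0$-coefficients along $X$ and $z\partial_z$; the one for
  -- $D^{(0,1)}(A^\flat)$ is the $z^1$-coefficient along $\bar X$.
  refine ⟨hC, hU, hg, fun y => (-1 : ℂ) • T.conj y (Ψ.A 1 y), fun y => (-1 : ℂ) • Ψ.A 1 y,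
    (T.isSmoothEnd_conj (Ψ.A_smooth 1)).const_smul _, fun x a b => ?_, fun x a b => ?_,
    fun u s hu hs x hx X => ⟨?_, hbar u s hu hs x hx X, ?_⟩, fun x => ?_⟩
  · have h := T.g_conj (hsymm x) a b
    simp only [LinearMap.smul_apply, map_smul, h]
  · have h := T.g_conj (hsymm x) a (T.κ x b)
    rw [T.conj_apply x _ (T.κ x b), T.κ_invol] at h
    simp only [T.h_eq, LinearMap.smul_apply, map_smul, map_smulₛₗ, h]
    simp
  · have h := gaugeDefect_d_eq_zero hT hC hU hg hΨ hu hx hs X 0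
    simp only [gaugeDefect, LinearMap.zero_apply, add_zero, zero_add, Ψ.coeff_zero, hone,
      Module.End.one_apply] at h
    simp only [LinearMap.smul_apply, map_smul]
    linear_combination (norm := module) h
  · have h := gaugeDefect_dbar_eq_zero hT hU hg hΨ hbar hu hx hs X 1
    simp only [gaugeDefect, LinearMap.zero_apply, map_zero, add_zero, sub_zero, sub_self,
      Ψ.coeff_zero, hone, Module.End.one_apply] at h
    have h2 := (T.D.isDerivationAt_dbar x X).csmul (-1) u _ hu hx (Ψ.A_smooth 1 u s hu hs)
    have h3 : T.D.dbar (fun y => ((-1 : ℂ) • Ψ.A 1 y) (s y)) x X =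
        (-1 : ℂ) • T.D.dbar (fun y => Ψ.A 1 y (s y)) x X := h2
    rw [h3, hbar u s hu hs x hx X, LinearMap.smul_apply]
    change _ = T.conj x (T.C x X) (s x)
    linear_combination (norm := module) -h
  · have h := hΨ x 0
    simp only [zero_add, Ψ.coeff_zero, Ψ.coeff_of_neg (show (0 : ℤ) - 1 < 0 by simp), hone,
      mul_one, one_mul, mul_zero, Int.cast_zero, zero_smul, add_zero, sub_zero] at h
    rw [mul_smul_comm, smul_mul_assoc]
    linear_combination (norm := module) -h

end Solution

end Main

end

end TTStar

/-! ### The theorem. -/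

theorem mainTheorem6
    {E : Type*} [NormedAddCommGroup E] [NormedSpace ℂ E] [FiniteDimensional ℂ E]
    {M : Type*} [TopologicalSpace M] [T2Space M] [SecondCountableTopology M] [ChartedSpace E M]
    [IsManifold 𝓘(ℂ, E) ω M] [SimplyConnectedSpace M]
    {F : Type*} [NormedAddCommGroup F] [NormedSpace ℂ F] [FiniteDimensional ℂ F]
    {K : M → Type*} [TopologicalSpace (TotalSpace F K)]
    [∀ x, AddCommGroup (K x)] [∀ x, Module ℂ (K x)] [∀ x, TopologicalSpace (K x)]
    [∀ x, IsTopologicalAddGroup (K x)] [∀ x, ContinuousSMul ℂ (K x)]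
    [FiberBundle F K] [VectorBundle ℂ F K] [ContMDiffVectorBundle ω F K 𝓘(ℂ, E)]
    (S : TTStar.SaitoStructure E F K) (T : TTStar.CVStructure E F K) (w : ℤ)
    (hS : S.IsSemisimple) (hT : T.IsSemisimple)
    (hA : TTStar.ACondition S T w (-1 : ℤ)) :
    (∀ k : WithTop ℤ, 0 ≤ k → TTStar.ACondition S T w k) ∧ TTStar.IsHarmonicPotential S T := by
  obtain ⟨hC, hU, hg, hbar⟩ := hA.higgs_eq
  obtain ⟨Ψ, hΨ⟩ := TTStar.CVStructure.exists_formal_solution hT (TTStar.isSkew_V hg)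
    S.V_holo.isSmoothEnd
  exact ⟨fun k _ => TTStar.aCondition_of_formalSolution hT hC hU hg hΨ hbar k,
    TTStar.isHarmonicPotential_of_formalSolution hT hC hU hg hΨ hbar⟩
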